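/- **Adam.** Given a stochastic gradient map $g:\mathbb R^d\times\Xi\to\mathbb R^d$ (jointly measurable; written $\nabla f(x,\xi)$), random samples $\xi_1,\xi_2,\dots$ with values in $\Xi$, a starting point $x_1\in\mathbb R^d$ and parameters $\beta\in(0,1]$, $\beta_{\rm sq}\in[0,1]$, $\eta>0$, $\lambda>0$, put $m_0=v_0=0$ and for $t=1,2,\dots$ $$m_t=(1-\beta)m_{t-1}+\beta\,\nabla f(x_t,\xi_t),\quad v_t=(1-\beta_{\rm sq})v_{t-1}+\beta_{\rm sq}\,(\nabla f(x_t,\xi_t))^2,$$ $$\hat m_t=\frac{m_t}{1-(1-\beta)^t},\quad \hat v_t=\frac{v_t}{1-(1-\beta_{\rm sq})^t},\quad x_{t+1}=x_t-\frac{\eta}{\sqrt{\hat v_t}+\lambda}\odot\hat m_t,$$ with squares, roots, quotients and $\odot$ taken coordinatewise, and $\hat v_t=0$ if $\beta_{\rm sq}=0$. **Assumptions.** Let $L_0,L_\rho,\sigma\ge0$, $0\le\rho<1$, $\lambda>0$. (i) $f$ is real-valued and twice differentiable on an open set $D\subseteq\mathbb R^d$ containing $x_1$, $\inf_D f>-\infty$,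 and $\|\nabla^2f(x)\|\le L_0+L_\rho\|\nabla f(x)\|^\rho$ for almost every $x\in D$ (Euclidean and spectral norm). (ii) For all $t\ge1$, $\mathbb E[\nabla f(x_t,\xi_t)\mid\xi_1,\dots,\xi_{t-1}]=\nabla f(x_t)$ and $\|\nabla f(x_t,\xi_t)-\nabla f(x_t)\|\le\sigma$ almost surely. (iii) Almost surely the segments $[x_t,x_{t+1}]$, $t\ge1$, lie in $D$ (this is automatic if $D=\mathbb R^d$). Put $\Delta_1=f(x_1)-\inf_Df$, $\iota=\log(1/\delta)$ and, for $G>0$, $$r=\min\Big\{\frac1{5L_\rho G^{\rho-1}},\ \frac1{5(L_0^{\rho-1}L_\rho)^{1/\rho}}\Big\},\qquad L=3L_0+4L_\rho G^\rho,$$ where a positive number divided by $0$ is $+\infty$ and the second term of $r$ is omitted if $\rho=0$ or $L_0=0$. **Theorem.** Let $0<\delta_0<1$. If $C_1,C_2$ are large enough, depending only on $\delta_0$, and then $c_1,c_2>0$ are small enough, depending only on $\delta_0,C_1,C_2$, the following holds. (a) Let $d$, $f$, $D$, $x_1$, the samples and the stochastic gradients be as above, let $0<\delta\le\delta_0$,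 $\varepsilon>0$, and let $$G\ge\max\Big\{2\lambda,\ 2\sigma,\ 2\|\nabla f(x_1)\|,\ C_1\Delta_1L_0/\lambda,\ (C_1\Delta_1L_\rho/\lambda)^{\frac1{1-\rho}}\Big\}.$$ Choose $0\le\beta_{\rm sq}\le1$ and $$0<\beta\le\min\Big\{1,\frac{c_1\lambda\varepsilon^2}{\sigma^2G\sqrt\iota}\Big\},\quad 0<\eta\le c_2\min\Big\{\frac{r\lambda}{G},\frac{\lambda^2\beta}{GL\sqrt\iota}\Big\},\quad T=\Big\lceil\max\Big\{\frac1{\beta^2},\frac{C_2\Delta_1G}{\eta\varepsilon^2}\Big\}\Big\rceil.$$ Then, with probability at least $1-\delta$, $\|\nabla f(x_t)\|\le G$ for every $1\le t\le T$ and $$\frac1T\sum_{t=1}^T\|\nabla f(x_t)\|^2\le\varepsilon^2.$$ (b) (Dimension-free $O(\varepsilon^{-4})$ complexity.) For all $L_0,L_\rho,\rho,\sigma,\lambda$ as above, $0<\delta\le\delta_0$, $G>0$ and $\Delta_1\ge0$ there is a constant $K$, depending on these and on $c_1,c_2,C_2$ but not on $d$ or $\varepsilon$, such that for every $0<\varepsilon\le1$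 there are $\beta,\eta$ satisfying the conditions in (a) for which $T\le K\varepsilon^{-4}$. -/

import Mathlib

open MeasureTheory
open scoped ENNReal

noncomputable section

namespace AdamConv

/-- `ℝ^d` with the Euclidean norm. -/
abbrev Vec (d : ℕ) : Type := EuclideanSpace ℝ (Fin d)

/-! ### The algorithm -/

/-- The variables that Adam carries: the current iterate and the two (uncorrected) momenta. -/
structure State (d : ℕ) where
  x : Vec d
  m : Vec d
  v : Vec d

/-- Iteration number `t ≥ 1` of Adam with stochastic gradient map `g`, sample `ξ`, momentum
parameters `β`, `βsq`, stepsize `η` and regularizer `lam`.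
If `βsq = 0` then `v = 0`, and the corrected second momentum `v / (1 - (1 - βsq) ^ t)` is
read as `0` as well. -/
def step {d : ℕ} {Ξ : Type*} (g : Vec d → Ξ → Vec d) (β βsq η lam : ℝ)
    (t : ℕ) (ξ : Ξ) (s : State d) : State d :=
  let grad : Vec d := g s.x ξ
  let m : Vec d := (1 - β) • s.m + β • grad
  let v : Vec d := WithLp.toLp 2 fun i => (1 - βsq) * s.v i + βsq * (grad i) ^ 2
  let mhat : Vec d := WithLp.toLp 2 fun i => m i / (1 - (1 - β) ^ t)
  let vhat : Vec d := WithLp.toLp 2 fun i => v i / (1 - (1 - βsq) ^ t)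
  { x := WithLp.toLp 2 fun i => s.x i - η / (Real.sqrt (vhat i) + lam) * mhat i
    m := m
    v := v }

/-- The state after `t` iterations, which use the samples `ξ 1, …, ξ t`. -/
def run {d : ℕ} {Ξ : Type*} (g : Vec d → Ξ → Vec d) (β βsq η lam : ℝ) (xinit : Vec d)
    (ξ : ℕ → Ξ) : ℕ → State d
  | 0 => { x := xinit, m := 0, v := 0 }
  | t + 1 => step g β βsq η lam (t + 1) (ξ (t + 1)) (run g β βsq η lam xinit ξ t)

/-- The iterate `x_t` for `t ≥ 1`: `x_1 = xinit`, and `x_{t+1}` is produced by iteration `t`. -/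
def iterate {d : ℕ} {Ξ : Type*} (g : Vec d → Ξ → Vec d) (β βsq η lam : ℝ) (xinit : Vec d)
    (ξ : ℕ → Ξ) (t : ℕ) : Vec d :=
  (run g β βsq η lam xinit ξ (t - 1)).x

/-! ### The objective and the noise -/

/-- `f` is twice differentiable on its (open) domain `D`, and
`‖∇² f(x)‖ ≤ L₀ + Lρ ‖∇ f(x)‖ ^ ρ` for almost every `x ∈ D`. -/
structure IsL0LrhoSmoothOn {d : ℕ} (f : Vec d → ℝ) (D : Set (Vec d)) (L₀ Lρ ρ : ℝ) : Prop where
  differentiable : ∀ x ∈ D, DifferentiableAt ℝ f x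
  twice_differentiable : ∀ x ∈ D, DifferentiableAt ℝ (gradient f) x
  hessian_bound : ∀ᵐ x ∂(volume.restrict D),
    ‖fderiv ℝ (gradient f) x‖ ≤ L₀ + Lρ * ‖gradient f x‖ ^ ρ

/-- The σ-algebra generated by `ξ_1, …, ξ_{t-1}`. -/
@[reducible] def past {Ω Ξ : Type*} [MeasurableSpace Ξ] (ξ : ℕ → Ω → Ξ) (t : ℕ) : MeasurableSpace Ω :=
  ⨆ s ∈ {s : ℕ | 1 ≤ s ∧ s < t}, MeasurableSpace.comap (ξ s) inferInstance

/-- For every `t ≥ 1` the stochastic gradient at `X_t` is conditionally unbiased given the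
previous samples, and its error is almost surely at most `σ`. -/
structure BoundedNoise {d : ℕ} {Ω Ξ : Type*} [MeasurableSpace Ω] [MeasurableSpace Ξ]
    (μ : Measure Ω) (f : Vec d → ℝ) (g : Vec d → Ξ → Vec d) (ξ : ℕ → Ω → Ξ)
    (X : ℕ → Ω → Vec d) (σ : ℝ) : Prop where
  unbiased : ∀ t : ℕ, 1 ≤ t →
    μ[fun ω => g (X t ω) (ξ t ω) | past ξ t] =ᵐ[μ] fun ω => gradient f (X t ω)
  bounded : ∀ t : ℕ, 1 ≤ t →
    ∀ᵐ ω ∂μ, ‖g (X t ω) (ξ t ω) - gradient f (X t ω)‖ ≤ σ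

/-! ### Constants and parameters -/

/-- The initial gap `f(x_1) - inf_{x ∈ D} f(x)`. -/
def gap {d : ℕ} (f : Vec d → ℝ) (D : Set (Vec d)) (xinit : Vec d) : ℝ :=
  f xinit - sInf (f '' D)

/-- `r = min {1 / (5 Lρ G^{ρ-1}), 1 / (5 (L₀^{ρ-1} Lρ)^{1/ρ})}` in `[0, ∞]`, where `1 / 0 = ∞`.
The second term has no meaning if `ρ = 0` or `L₀ = 0` (as `ρ < 1`), and is then left out. -/
def radius (L₀ Lρ ρ G : ℝ) : ℝ≥0∞ :=
  min (1 / (5 * ENNReal.ofReal Lρ * ENNReal.ofReal G ^ (ρ - 1)))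
    (if ρ = 0 ∨ L₀ = 0 then ⊤
      else 1 / (5 * (ENNReal.ofReal L₀ ^ (ρ - 1) * ENNReal.ofReal Lρ) ^ (1 / ρ)))

/-- The effective smoothness constant `L = 3 L₀ + 4 Lρ G^ρ`. -/
def effSmooth (L₀ Lρ ρ G : ℝ) : ℝ := 3 * L₀ + 4 * Lρ * G ^ ρ

/-- The conditions on `β` and `η`, with `ι = log (1/δ)`. The right-hand sides are computed in
`[0, ∞]`, so that a fraction with positive numerator and denominator `0` is `∞`. -/
structure Admissible (c₁ c₂ δ ε σ lam L₀ Lρ ρ G β η : ℝ) : Prop where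
  β_pos : 0 < β
  η_pos : 0 < η
  β_le : ENNReal.ofReal β ≤
    min 1 (ENNReal.ofReal (c₁ * lam * ε ^ 2) /
      ENNReal.ofReal (σ ^ 2 * G * Real.sqrt (Real.log (1 / δ))))
  η_le : ENNReal.ofReal η ≤
    ENNReal.ofReal c₂ *
      min (radius L₀ Lρ ρ G * ENNReal.ofReal lam / ENNReal.ofReal G)
        (ENNReal.ofReal (lam ^ 2 * β) /
          ENNReal.ofReal (G * effSmooth L₀ Lρ ρ G * Real.sqrt (Real.log (1 / δ))))

/-- The number of iterations `T = max {1/β², C₂ Δ₁ G / (η ε²)}`, rounded up to an integer. -/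
def horizon (C₂ Δ₁ G ε β η : ℝ) : ℕ :=
  ⌈max (1 / β ^ 2) (C₂ * Δ₁ * G / (η * ε ^ 2))⌉₊

end AdamConv

end

namespace AdamConv

open Filter Topology Set

/-! Bias correction makes the corrected momentum a genuine weighted average of the stochastic
gradients, in which the newest one has weight `α_t = β / (1 - (1 - β) ^ t)`. Of the second momentum
only the size matters: while the gradients are at most `G` and the noise is at most `G / 2`, every
coordinate is moved with a stepsize between `η / (2 G)` and `η / lam`. Hence each step lowers `f` by
order `η / G` times the squared gradient, up to `η / lam` times the squared error of the momentum.
This is proved coordinate by coordinate (`preconditioned_step`), so no dimension enters.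

The error of the momentum is the averaged noise plus the lag of the averaged gradient behind the
current one. The lag contracts by `1 - β` per step and is fed by the change of the gradient, which
is at most `L η / lam` times the momentum. As `L η / lam` is small against `β`, the lag is absorbed
(`descent_sum`). Expanding the square of the averaged noise recursively leaves a martingale of
bounded cross terms, to which Azuma–Hoeffding applies (`measure_lt_sum_le`); `T ≥ 1 / β ^ 2` makes
the sum of the `α_t ^ 2` of order `β ^ 2 T`.

The noise bound holds along the whole run, so the event that the cross terms are small does not
involve `G`, and no stopping time is needed. On this event a bootstrap is deterministic
(`gradients_along_run`): if all earlier gradients are at most `G`, the summed descent bounds their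
squares, and a slowly moving sequence starting below `G / 2` cannot exceed `G` without a larger sum
of squares (`norm_le_half_add_sum`). The lower bounds on `G` make this budget sufficient. Dividing
the summed descent by `T` gives the mean square bound. -/

/-! ### Smoothness -/

/-- A differentiable curve whose derivative is almost everywhere bounded by `B` is `B`-Lipschitz
(the derivative exists everywhere but need not be continuous). -/
lemma norm_sub_le_of_ae_norm_deriv_le {F : Type*} [NormedAddCommGroup F] [NormedSpace ℝ F]
    [CompleteSpace F] {φ : ℝ → F} {B : ℝ}
    (hφ : ∀ s ∈ Icc (0 : ℝ) 1, DifferentiableAt ℝ φ s)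
    (hB : ∀ᵐ s : ℝ, s ∈ Icc (0 : ℝ) 1 → ‖deriv φ s‖ ≤ B) : ‖φ 1 - φ 0‖ ≤ B := by
  have hB' : ∀ᵐ s : ℝ, s ∈ uIoc (0 : ℝ) 1 → ‖deriv φ s‖ ≤ B := by
    filter_upwards [hB] with s hs h
    rw [uIoc_of_le zero_le_one] at h
    exact hs (Ioc_subset_Icc_self h)
  -- A derivative is measurable, so an almost everywhere bound makes it integrable. This is all that
  -- the fundamental theorem needs when the derivative exists everywhere.
  have hint : IntervalIntegrable (deriv φ) volume 0 1 := by
    have hc : IntervalIntegrable (fun _ : ℝ => B) volume 0 1 := intervalIntegrable_const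
    refine hc.mono_fun' ?_ ?_
    · exact aestronglyMeasurable_deriv φ _
    · exact (ae_restrict_iff' measurableSet_uIoc).2 hB'
  have h := intervalIntegral.integral_eq_sub_of_hasDerivAt (f := φ) (f' := deriv φ) (a := 0) (b := 1)
    (fun s hs => (hφ s (by rwa [uIcc_of_le zero_le_one] at hs)).hasDerivAt) hint
  rw [← h]
  simpa using intervalIntegral.norm_integral_le_of_norm_le_const_ae hB'

/-- If a map is differentiable near `x₀` and its derivative is bounded by `B` almost everywhere
near `x₀`, then it is bounded by `B` at `x₀`. -/
lemma norm_fderiv_le_of_ae_norm_fderiv_le {E F : Type*} [NormedAddCommGroup E] [NormedSpace ℝ E]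
    [FiniteDimensional ℝ E] [MeasurableSpace E] [BorelSpace E] (ν : Measure E)
    [ν.IsAddHaarMeasure] [NormedAddCommGroup F] [NormedSpace ℝ F] [CompleteSpace F]
    {h : E → F} {x₀ : E} {U : Set E} {B : ℝ} (hB₀ : 0 ≤ B) (hU : U ∈ 𝓝 x₀)
    (hd : ∀ x ∈ U, DifferentiableAt ℝ h x)
    (hB : ∀ᵐ x ∂ν, x ∈ U → ‖fderiv ℝ h x‖ ≤ B) : ‖fderiv ℝ h x₀‖ ≤ B := by
  have : ProperSpace E := FiniteDimensional.proper ℝ E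
  obtain ⟨R, hR, hRU⟩ := Metric.mem_nhds_iff.1 hU
  refine norm_fderiv_le_of_lip' ℝ hB₀ ?_
  filter_upwards [Metric.ball_mem_nhds x₀ hR] with x hx
  set w := x - x₀ with hw
  have hwR : ‖w‖ < R := by rwa [hw, ← dist_eq_norm]
  obtain ⟨A, hA, hAm, hAB⟩ := hB.exists_measurable_mem
  -- Fubini: almost every line parallel to `w` meets the exceptional set in a null set. The segment
  -- from `x₀` to `x` may lie on a bad line, but good lines come arbitrarily close, and continuity
  -- of `h` carries the Lipschitz bound over.
  have hae := (ae_ae_add_linearMap_mem_iff (LinearMap.toSpanSingleton ℝ E w) (volume : Measure ℝ)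
    ν hAm).2 hA
  have hfreq : ∃ᶠ y in 𝓝 x₀, ∀ᵐ s : ℝ, y + s • w ∈ A := by
    have := (Measure.dense_of_ae hae) x₀
    simpa using mem_closure_iff_frequently.1 this
  have hnear : ∀ᶠ y in 𝓝 x₀, y ∈ Metric.ball x₀ (R - ‖w‖) :=
    Metric.ball_mem_nhds x₀ (by linarith)
  have key : ∃ᶠ y in 𝓝 x₀, ‖h (y + w) - h y‖ ≤ B * ‖w‖ := by
    refine (hfreq.and_eventually hnear).mono ?_
    rintro y ⟨hy, hyR⟩
    have hin : ∀ s ∈ Icc (0 : ℝ) 1, y + s • w ∈ U := by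
      intro s hs
      apply hRU
      rw [Metric.mem_ball, dist_eq_norm] at hyR ⊢
      calc ‖y + s • w - x₀‖ = ‖(y - x₀) + s • w‖ := by congr 1; abel
        _ ≤ ‖y - x₀‖ + ‖s • w‖ := norm_add_le _ _
        _ ≤ ‖y - x₀‖ + ‖w‖ := by
          gcongr
          rw [norm_smul, Real.norm_of_nonneg hs.1]
          exact mul_le_of_le_one_left (norm_nonneg _) hs.2
        _ < R := by linarith
    have hder : ∀ s ∈ Icc (0 : ℝ) 1,
        HasDerivAt (fun s : ℝ => h (y + s • w)) (fderiv ℝ h (y + s • w) w) s := by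
      intro s hs
      have h1 : HasDerivAt (fun s : ℝ => y + s • w) w s := by
        simpa using ((hasDerivAt_id s).smul_const w).const_add y
      exact (hd _ (hin s hs)).hasFDerivAt.comp_hasDerivAt s h1
    have := norm_sub_le_of_ae_norm_deriv_le (φ := fun s : ℝ => h (y + s • w)) (B := B * ‖w‖)
      (fun s hs => (hder s hs).differentiableAt) (by
        filter_upwards [hy] with s hs hs1
        rw [(hder s hs1).deriv]
        exact (ContinuousLinearMap.le_opNorm _ _).trans
          (mul_le_mul_of_nonneg_right (hAB _ hs (hin s hs1)) (norm_nonneg _)))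
    simpa using this
  have hxU : x₀ + w ∈ U := hRU (by simpa [hw] using hx)
  have hlim : Tendsto (fun y => ‖h (y + w) - h y‖) (𝓝 x₀) (𝓝 ‖h (x₀ + w) - h x₀‖) := by
    have h1 : ContinuousAt (fun y => h (y + w)) x₀ :=
      ContinuousAt.comp (g := h) (hd _ hxU).continuousAt (by fun_prop)
    exact (h1.sub (hd _ (mem_of_mem_nhds hU)).continuousAt).norm
  have := le_of_tendsto_of_frequently hlim key
  simpa [hw] using this

section smooth

variable {d : ℕ} {f : Vec d → ℝ} {D : Set (Vec d)} {L₀ Lρ ρ : ℝ}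

/-- The Hessian bound holds at every point of the domain. -/
lemma IsL0LrhoSmoothOn.hessian_le (hf : IsL0LrhoSmoothOn f D L₀ Lρ ρ) (hD : IsOpen D)
    (hL₀ : 0 ≤ L₀) (hLρ : 0 ≤ Lρ) (hρ : 0 ≤ ρ) {x : Vec d} (hx : x ∈ D) :
    ‖fderiv ℝ (gradient f) x‖ ≤ L₀ + Lρ * ‖gradient f x‖ ^ ρ := by
  have hae := (ae_restrict_iff' hD.measurableSet).1 hf.hessian_bound
  -- The bound varies with the point. It is frozen at a level `M` above the gradient norm at `x`,
  -- valid nearby by continuity, and then `M` decreases to that norm.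
  have hM : ∀ M : ℝ, ‖gradient f x‖ < M →
      ‖fderiv ℝ (gradient f) x‖ ≤ L₀ + Lρ * M ^ ρ := by
    intro M hM
    have hM0 : 0 ≤ M := (norm_nonneg _).trans hM.le
    have hcont : ContinuousAt (fun y => ‖gradient f y‖) x :=
      (hf.twice_differentiable x hx).continuousAt.norm
    have hU : D ∩ {y | ‖gradient f y‖ < M} ∈ 𝓝 x :=
      inter_mem (hD.mem_nhds hx) (hcont.eventually_lt_const hM)
    refine norm_fderiv_le_of_ae_norm_fderiv_le volume (by positivity) hU
      (fun y hy => hf.twice_differentiable y hy.1) ?_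
    filter_upwards [hae] with y hy hyU
    refine (hy hyU.1).trans ?_
    gcongr
    exact le_of_lt hyU.2
  have hlim : Tendsto (fun M : ℝ => L₀ + Lρ * M ^ ρ) (𝓝[>] ‖gradient f x‖)
      (𝓝 (L₀ + Lρ * ‖gradient f x‖ ^ ρ)) := by
    have : Continuous fun M : ℝ => L₀ + Lρ * M ^ ρ := by
      have := Real.continuous_rpow_const hρ
      fun_prop
    exact (this.tendsto _).mono_left nhdsWithin_le_nhds
  refine ge_of_tendsto hlim ?_
  filter_upwards [self_mem_nhdsWithin] with M hM' using hM M hM'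

/-- The a priori bound `2 τ` on the gradient within distance `s` of a point with gradient at most
`G`. -/
lemma exists_gradient_threshold {G s : ℝ} (hL₀ : 0 ≤ L₀) (hLρ : 0 ≤ Lρ) (hρ : 0 ≤ ρ) (hρ1 : ρ < 1)
    (hG : 0 < G) (hs : 0 ≤ s) (hr : ENNReal.ofReal s ≤ radius L₀ Lρ ρ G) :
    ∃ τ : ℝ, G ≤ τ ∧ L₀ + Lρ * (2 * τ) ^ ρ ≤ effSmooth L₀ Lρ ρ G ∧
      s * (L₀ + Lρ * (2 * τ) ^ ρ) < τ := by
  have htwo : (2 : ℝ) ^ ρ ≤ 2 := by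
    simpa using Real.rpow_le_rpow_of_exponent_le (x := 2) (by norm_num) hρ1.le
  -- In the degenerate cases `ρ = 0` and `Lρ = 0` the Hessian bound does not depend on `τ`, so any
  -- large `τ` will do.
  rcases hρ.eq_or_lt with rfl | hρ0
  · refine ⟨max G (s * (L₀ + Lρ) + 1), le_max_left _ _, ?_, ?_⟩
    · simp only [effSmooth, Real.rpow_zero]; linarith
    · simp only [Real.rpow_zero, mul_one]
      exact lt_of_lt_of_le (by linarith) (le_max_right _ _)
  rcases hLρ.eq_or_lt with rfl | hLρ0
  · refine ⟨max G (s * L₀ + 1), le_max_left _ _, ?_, ?_⟩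
    · simp only [effSmooth, zero_mul, mul_zero, add_zero]; linarith
    · simp only [zero_mul, add_zero]
      exact lt_of_lt_of_le (by linarith) (le_max_right _ _)
  have hr1 := hr.trans (min_le_left _ _)
  have hr2 := hr.trans (min_le_right _ _)
  -- The two terms of the radius serve the two regimes. If the `Lρ` term dominates at `G`, then `τ =
  -- G`, and the first term of the radius gives `s * (Lρ * G ^ ρ) ≤ G / 5`.
  rcases le_or_gt L₀ (Lρ * G ^ ρ) with hcase | hcase
  · have h1 : s * (5 * Lρ * G ^ (ρ - 1)) ≤ 1 := by
      have := ENNReal.mul_le_of_le_div hr1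
      rw [ENNReal.ofReal_rpow_of_pos hG, show (5 : ℝ≥0∞) = ENNReal.ofReal 5 by simp,
        ← ENNReal.ofReal_mul (by norm_num), ← ENNReal.ofReal_mul (by positivity),
        ← ENNReal.ofReal_mul hs] at this
      exact ENNReal.ofReal_le_one.1 this
    have h2 : G ^ ρ = G ^ (ρ - 1) * G := by
      rw [Real.rpow_sub_one hG.ne']; field_simp
    have h3 : (2 * G) ^ ρ ≤ 2 * G ^ ρ := by
      rw [Real.mul_rpow (by norm_num) hG.le]; gcongr
    have h4 : Lρ * (2 * G) ^ ρ ≤ 2 * (Lρ * G ^ ρ) := by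
      calc Lρ * (2 * G) ^ ρ ≤ Lρ * (2 * G ^ ρ) := by gcongr
        _ = _ := by ring
    refine ⟨G, le_rfl, ?_, ?_⟩
    · unfold effSmooth
      have : 0 ≤ Lρ * G ^ ρ := by positivity
      linarith
    · have h5 : s * (Lρ * G ^ ρ) ≤ G / 5 := by
        rw [h2]
        have := mul_le_mul_of_nonneg_right h1 hG.le
        linarith
      have h6 : s * (L₀ + Lρ * (2 * G) ^ ρ) ≤ s * (3 * (Lρ * G ^ ρ)) := by
        gcongr; linarith
      linarith
  · have hL₀0 : 0 < L₀ := lt_of_le_of_lt (by positivity) hcase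
    rw [if_neg (by simp [hρ0.ne', hL₀0.ne'])] at hr2
    have h1 : s * (5 * (L₀ ^ (ρ - 1) * Lρ) ^ (1 / ρ)) ≤ 1 := by
      have := ENNReal.mul_le_of_le_div hr2
      rw [ENNReal.ofReal_rpow_of_pos hL₀0, ← ENNReal.ofReal_mul (by positivity),
        ENNReal.ofReal_rpow_of_pos (by positivity), show (5 : ℝ≥0∞) = ENNReal.ofReal 5 by simp,
        ← ENNReal.ofReal_mul (by norm_num), ← ENNReal.ofReal_mul hs] at this
      exact ENNReal.ofReal_le_one.1 this
    -- The gradient size at which `L₀` and `Lρ * τ ^ ρ` balance; here it is at least `G`, and the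
    -- second term of the radius says `s * L₀ ≤ τ / 5`.
    set τ : ℝ := (L₀ / Lρ) ^ (1 / ρ) with hτ
    have hτ0 : 0 < τ := by positivity
    have hτρ : τ ^ ρ = L₀ / Lρ := by
      rw [hτ, ← Real.rpow_mul (by positivity), one_div_mul_cancel hρ0.ne', Real.rpow_one]
    have hGτ : G ≤ τ := by
      rw [← Real.rpow_le_rpow_iff hG.le hτ0.le hρ0, hτρ, le_div_iff₀ hLρ0]
      linarith
    have h2 : (L₀ ^ (ρ - 1) * Lρ) ^ (1 / ρ) * τ = L₀ := by
      rw [hτ, ← Real.mul_rpow (by positivity) (by positivity)]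
      have : L₀ ^ (ρ - 1) * Lρ * (L₀ / Lρ) = L₀ ^ ρ := by
        rw [Real.rpow_sub_one hL₀0.ne']; field_simp
      rw [this, ← Real.rpow_mul hL₀, mul_one_div_cancel hρ0.ne', Real.rpow_one]
    have h3 : Lρ * (2 * τ) ^ ρ ≤ 2 * L₀ := by
      rw [Real.mul_rpow (by norm_num) hτ0.le, hτρ]
      calc Lρ * (2 ^ ρ * (L₀ / Lρ)) = 2 ^ ρ * L₀ := by field_simp
        _ ≤ 2 * L₀ := by gcongr
    have h4 : s * L₀ ≤ τ / 5 := by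
      have := mul_le_mul_of_nonneg_right h1 hτ0.le
      have h5 : s * (5 * (L₀ ^ (ρ - 1) * Lρ) ^ (1 / ρ)) * τ = 5 * (s * L₀) := by
        calc _ = 5 * (s * ((L₀ ^ (ρ - 1) * Lρ) ^ (1 / ρ) * τ)) := by ring
          _ = _ := by rw [h2]
      linarith
    refine ⟨τ, hGτ, ?_, ?_⟩
    · unfold effSmooth
      have : 0 ≤ Lρ * G ^ ρ := by positivity
      linarith
    · have : s * (L₀ + Lρ * (2 * τ) ^ ρ) ≤ s * (3 * L₀) := by gcongr; linarith
      linarith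

/-- Local smoothness: within the radius, the gradient is Lipschitz with the effective constant. -/
lemma IsL0LrhoSmoothOn.norm_gradient_sub_le (hf : IsL0LrhoSmoothOn f D L₀ Lρ ρ) (hD : IsOpen D)
    (hL₀ : 0 ≤ L₀) (hLρ : 0 ≤ Lρ) (hρ : 0 ≤ ρ) (hρ1 : ρ < 1) {G : ℝ} (hG : 0 < G) {x y : Vec d}
    (hseg : segment ℝ x y ⊆ D) (hx : ‖gradient f x‖ ≤ G)
    (hr : ENNReal.ofReal ‖y - x‖ ≤ radius L₀ Lρ ρ G) :
    ‖gradient f y - gradient f x‖ ≤ effSmooth L₀ Lρ ρ G * ‖y - x‖ := by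
  obtain ⟨τ, hGτ, hKL, hKτ⟩ :=
    exists_gradient_threshold hL₀ hLρ hρ hρ1 hG (norm_nonneg (y - x)) hr
  set K : ℝ := L₀ + Lρ * (2 * τ) ^ ρ with hK
  have hτ0 : 0 < τ := hG.trans_le hGτ
  have hK0 : 0 ≤ K := by positivity
  set u : ℝ → Vec d := fun s => gradient f (x + s • (y - x)) with hu
  have hin : ∀ s ∈ Icc (0 : ℝ) 1, x + s • (y - x) ∈ D := by
    intro s hs
    apply hseg
    rw [segment_eq_image']
    exact ⟨s, hs, rfl⟩
  have hder : ∀ s ∈ Icc (0 : ℝ) 1,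
      HasDerivAt u (fderiv ℝ (gradient f) (x + s • (y - x)) (y - x)) s := by
    intro s hs
    have h1 : HasDerivAt (fun s : ℝ => x + s • (y - x)) (y - x) s := by
      simpa using ((hasDerivAt_id s).smul_const (y - x)).const_add x
    exact (hf.twice_differentiable _ (hin s hs)).hasFDerivAt.comp_hasDerivAt s h1
  -- Smallness is required only before time `b`, so that this applies at the first time at which the
  -- norm reaches `2 * τ`. By then `u` has moved by less than `τ` from a point of norm at most `G ≤
  -- τ`, a contradiction.
  have hbd : ∀ b ∈ Icc (0 : ℝ) 1, (∀ s ∈ Ico (0 : ℝ) b, ‖u s‖ < 2 * τ) →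
      ‖u b - u 0‖ ≤ K * ‖y - x‖ * b := by
    intro b hb hsmall
    have hsub : ∀ s ∈ Icc (0 : ℝ) b, s ∈ Icc (0 : ℝ) 1 := fun s hs => ⟨hs.1, hs.2.trans hb.2⟩
    have := norm_image_sub_le_of_norm_deriv_le_segment' (f := u) (C := K * ‖y - x‖)
      (fun s hs => (hder s (hsub s hs)).hasDerivWithinAt) (by
        intro s hs
        refine (ContinuousLinearMap.le_opNorm _ _).trans ?_
        gcongr
        refine (hf.hessian_le hD hL₀ hLρ hρ (hin s (hsub s ⟨hs.1, hs.2.le⟩))).trans ?_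
        rw [hK]
        gcongr
        exact (hsmall s hs).le) b ⟨hb.1, le_rfl⟩
    simpa using this
  have hu0 : ‖u 0‖ ≤ G := by simpa [hu] using hx
  have hsmall : ∀ s ∈ Icc (0 : ℝ) 1, ‖u s‖ < 2 * τ := by
    by_contra! hcon
    obtain ⟨s₁, hs₁, hbig₁⟩ := hcon
    have hcont : ContinuousOn (fun s => ‖u s‖) (Icc 0 1) :=
      fun s hs => (hder s hs).continuousAt.norm.continuousWithinAt
    have hcomp : IsCompact (Icc (0 : ℝ) 1 ∩ (fun s => ‖u s‖) ⁻¹' Ici (2 * τ)) :=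
      isCompact_Icc.of_isClosed_subset (hcont.preimage_isClosed_of_isClosed isClosed_Icc isClosed_Ici)
        inter_subset_left
    obtain ⟨b, ⟨hb, hbig⟩, hleast⟩ := hcomp.exists_isLeast ⟨s₁, hs₁, hbig₁⟩
    have h1 := hbd b hb (by
      intro s hs
      by_contra! hcon
      exact absurd (hleast ⟨⟨hs.1, hs.2.le.trans hb.2⟩, hcon⟩) (not_le.2 hs.2))
    have h2 : K * ‖y - x‖ * b ≤ ‖y - x‖ * K := by
      have : K * ‖y - x‖ * b ≤ K * ‖y - x‖ * 1 := by gcongr; exact hb.2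
      linarith
    have h3 : ‖u b‖ ≤ ‖u b - u 0‖ + ‖u 0‖ := by simpa using norm_add_le (u b - u 0) (u 0)
    have h4 : 2 * τ ≤ ‖u b‖ := hbig
    linarith
  have h := hbd 1 ⟨zero_le_one, le_rfl⟩ (fun s hs => hsmall s ⟨hs.1, hs.2.le⟩)
  simp only [hu, one_smul, add_sub_cancel, zero_smul, add_zero, mul_one] at h
  exact h.trans (by gcongr)

/-- The descent inequality within the radius. -/
lemma IsL0LrhoSmoothOn.le_add_inner_add (hf : IsL0LrhoSmoothOn f D L₀ Lρ ρ) (hD : IsOpen D)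
    (hL₀ : 0 ≤ L₀) (hLρ : 0 ≤ Lρ) (hρ : 0 ≤ ρ) (hρ1 : ρ < 1) {G : ℝ} (hG : 0 < G) {x y : Vec d}
    (hseg : segment ℝ x y ⊆ D) (hx : ‖gradient f x‖ ≤ G)
    (hr : ENNReal.ofReal ‖y - x‖ ≤ radius L₀ Lρ ρ G) :
    f y ≤ f x + inner ℝ (gradient f x) (y - x) + effSmooth L₀ Lρ ρ G * ‖y - x‖ ^ 2 := by
  have hL : 0 ≤ effSmooth L₀ Lρ ρ G := by unfold effSmooth; positivity
  have hbound : ∀ z ∈ segment ℝ x y,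
      ‖InnerProductSpace.toDual ℝ (Vec d) (gradient f z) -
        InnerProductSpace.toDual ℝ (Vec d) (gradient f x)‖ ≤ effSmooth L₀ Lρ ρ G * ‖y - x‖ := by
    intro z hz
    rw [← map_sub, LinearIsometryEquiv.norm_map]
    have hzx : ‖z - x‖ ≤ ‖y - x‖ := by
      rw [segment_eq_image'] at hz
      obtain ⟨s, hs, rfl⟩ := hz
      rw [add_sub_cancel_left, norm_smul, Real.norm_of_nonneg hs.1]
      exact mul_le_of_le_one_left (norm_nonneg _) hs.2
    have hsub : segment ℝ x z ⊆ segment ℝ x y :=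
      (convex_segment x y).segment_subset (left_mem_segment ℝ x y) hz
    refine (hf.norm_gradient_sub_le hD hL₀ hLρ hρ hρ1 hG (hsub.trans hseg) hx
      ((ENNReal.ofReal_le_ofReal hzx).trans hr)).trans ?_
    gcongr
  -- The mean value inequality for `f` minus its linear part at `x`. It gives the constant `L` in
  -- place of `L / 2`, which is harmless.
  have h := (convex_segment x y).norm_image_sub_le_of_norm_hasFDerivWithin_le'
    (fun z hz => (hf.differentiable z (hseg hz)).hasGradientAt.hasFDerivAt.hasFDerivWithinAt)
    hbound (left_mem_segment ℝ x y) (right_mem_segment ℝ x y)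
  rw [InnerProductSpace.toDual_apply_apply] at h
  have := (le_abs_self _).trans h
  rw [mul_assoc, ← pow_two] at this
  linarith

end smooth

/-! ### Weighted averages -/

/-- The weight of the newest term in the bias-corrected momentum number `k + 1`. -/
noncomputable def weight (β : ℝ) (k : ℕ) : ℝ := β / (1 - (1 - β) ^ (k + 1))

section weight

variable {β : ℝ}

lemma one_sub_pow_pos (hβ : 0 < β) (hβ1 : β ≤ 1) (k : ℕ) : 0 < 1 - (1 - β) ^ (k + 1) :=
  sub_pos.2 (pow_lt_one₀ (by linarith) (by linarith) (Nat.succ_ne_zero k))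

lemma le_weight (hβ : 0 < β) (hβ1 : β ≤ 1) (k : ℕ) : β ≤ weight β k := by
  rw [weight, le_div_iff₀ (one_sub_pow_pos hβ hβ1 k)]
  have : 0 ≤ (1 - β) ^ (k + 1) := pow_nonneg (by linarith) _
  nlinarith

lemma weight_le_one (hβ : 0 < β) (hβ1 : β ≤ 1) (k : ℕ) : weight β k ≤ 1 := by
  rw [weight, div_le_one (one_sub_pow_pos hβ hβ1 k)]
  have : (1 - β) ^ (k + 1) ≤ 1 - β := by
    rw [pow_succ]
    exact mul_le_of_le_one_left (by linarith) (pow_le_one₀ (by linarith) (by linarith))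
  linarith

/-- By Bernoulli `(1 - β) ^ n * (1 + n * β) ≤ (1 - β ^ 2) ^ n ≤ 1`, which bounds the normalizing
factor from below. The early weights are thus large, but only like `1 / n`, hence square summable.
-/
lemma weight_le_add (hβ : 0 < β) (hβ1 : β ≤ 1) (k : ℕ) : weight β k ≤ β + 1 / (k + 1) := by
  have hk : (0 : ℝ) < k + 1 := by positivity
  have h0 : 0 ≤ (1 - β) ^ (k + 1) := pow_nonneg (by linarith) _
  have hbern : 1 + (k + 1) * β ≤ (1 + β) ^ (k + 1) := by
    have := one_add_mul_le_pow (a := β) (by linarith) (k + 1)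
    push_cast at this
    exact this
  have hprod : (1 - β) ^ (k + 1) * (1 + (k + 1) * β) ≤ 1 := by
    calc (1 - β) ^ (k + 1) * (1 + (k + 1) * β) ≤ (1 - β) ^ (k + 1) * (1 + β) ^ (k + 1) := by gcongr
      _ = (1 - β ^ 2) ^ (k + 1) := by rw [← mul_pow]; ring
      _ ≤ 1 := pow_le_one₀ (by nlinarith) (by nlinarith)
  rw [weight, div_le_iff₀ (one_sub_pow_pos hβ hβ1 k)]
  have h1 : β + 1 / ((k : ℝ) + 1) = (1 + (k + 1) * β) / (k + 1) := by field_simp; ring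
  rw [h1, div_mul_eq_mul_div, le_div_iff₀ hk]
  nlinarith

lemma one_sub_weight_mul (hβ : 0 < β) (hβ1 : β ≤ 1) (k : ℕ) :
    (1 - (1 - β) ^ (k + 2)) * (1 - weight β (k + 1)) = (1 - β) * (1 - (1 - β) ^ (k + 1)) := by
  have := (one_sub_pow_pos hβ hβ1 (k + 1)).ne'
  rw [weight]
  field_simp
  ring

lemma sum_weight_sq_le (hβ : 0 < β) (hβ1 : β ≤ 1) (T : ℕ) :
    ∑ k ∈ Finset.range T, weight β (k + 1) ^ 2 ≤ 2 * β ^ 2 * T + 2 := by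
  -- The terms `1 / n ^ 2`, `n ≥ 2`, are compared with the telescoping differences `1 / (n - 1) - 1
  -- / n`; the induction carries the remainder.
  have h : ∑ k ∈ Finset.range T, weight β (k + 1) ^ 2 ≤
      2 * β ^ 2 * T + 2 * (1 - 1 / ((T : ℝ) + 1)) := by
    induction T with
    | zero => simp
    | succ T ih =>
      rw [Finset.sum_range_succ]
      have hw : weight β (T + 1) ^ 2 ≤ 2 * β ^ 2 + 2 * (1 / ((T : ℝ) + 2)) ^ 2 := by
        have h1 := weight_le_add hβ hβ1 (T + 1)
        have h2 := hβ.le.trans (le_weight hβ hβ1 (T + 1))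
        push_cast at h1
        rw [show (T : ℝ) + 1 + 1 = T + 2 by ring] at h1
        nlinarith [sq_nonneg (β - 1 / ((T : ℝ) + 2))]
      have hfrac : (1 / ((T : ℝ) + 2)) ^ 2 ≤ 1 / ((T : ℝ) + 1) - 1 / ((T : ℝ) + 2) := by
        rw [div_sub_div _ _ (by positivity) (by positivity), div_pow,
          div_le_div_iff₀ (by positivity) (by positivity)]
        nlinarith [(T.cast_nonneg : (0 : ℝ) ≤ T)]
      push_cast
      rw [show (T : ℝ) + 1 + 1 = T + 2 by ring]
      linarith
  have : 0 ≤ 1 / ((T : ℝ) + 1) := by positivity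
  linarith

end weight

/-- A sequence that starts below `G / 2` and moves by steps of at most `ℓ ≤ G / 4` can only grow at
the expense of its sum of squares. -/
lemma norm_le_half_add_sum {E : Type*} [NormedAddCommGroup E] {u : ℕ → E} {G ℓ : ℝ} (hG : 0 < G)
    (hℓ : 0 ≤ ℓ) (hℓG : ℓ ≤ G / 4)
    (h0 : ‖u 0‖ ≤ G / 2) (K : ℕ) (hu : ∀ k < K, ‖u (k + 1) - u k‖ ≤ ℓ) :
    ‖u K‖ ≤ G / 2 + 16 * ℓ / G ^ 2 * ∑ k ∈ Finset.range K, ‖u k‖ ^ 2 := by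
  induction K with
  | zero => simpa using h0
  | succ K ih =>
    have ih' := ih fun k hk => hu k (hk.trans K.lt_succ_self)
    have hstep : ‖u (K + 1)‖ ≤ ‖u K‖ + ℓ := by
      have := norm_add_le (u (K + 1) - u K) (u K)
      rw [sub_add_cancel] at this
      linarith [hu K K.lt_succ_self]
    -- A step from above `G / 4` is paid for by the new square. From below `G / 4`, one step leads
    -- at most to `G / 2`, and no past is needed.
    rcases le_or_gt (G / 4) ‖u K‖ with hK | hK
    · rw [Finset.sum_range_succ, mul_add]
      have : ℓ ≤ 16 * ℓ / G ^ 2 * ‖u K‖ ^ 2 := by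
        rw [div_mul_eq_mul_div, le_div_iff₀ (by positivity)]
        have : (G / 4) ^ 2 ≤ ‖u K‖ ^ 2 := by gcongr
        nlinarith
      linarith
    · have : 0 ≤ 16 * ℓ / G ^ 2 * ∑ k ∈ Finset.range (K + 1), ‖u k‖ ^ 2 :=
        mul_nonneg (by positivity) (Finset.sum_nonneg fun _ _ => sq_nonneg _)
      linarith

/-! ### Running averages: lag, accumulated noise and summed descent. -/

section average

variable {E : Type*} [NormedAddCommGroup E] [InnerProductSpace ℝ E] {α : ℕ → ℝ}

/-- The running average of `w` in which the term `w (k + 1)` enters with weight `α (k + 1)`. -/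
def average (α : ℕ → ℝ) (w : ℕ → E) : ℕ → E
  | 0 => w 0
  | k + 1 => (1 - α (k + 1)) • average α w k + α (k + 1) • w (k + 1)

lemma average_add (α : ℕ → ℝ) (u n : ℕ → E) (k : ℕ) :
    average α (fun j => u j + n j) k = average α u k + average α n k := by
  induction k with
  | zero => rfl
  | succ k ih => simp only [average, ih, smul_add]; abel

lemma norm_average_le {w : ℕ → E} {B : ℝ} (hα : ∀ k, 0 ≤ α k) (hα1 : ∀ k, α k ≤ 1) (k : ℕ)
    (hw : ∀ j ≤ k, ‖w j‖ ≤ B) : ‖average α w k‖ ≤ B := by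
  induction k with
  | zero => exact hw 0 le_rfl
  | succ k ih =>
    have h1 := ih fun j hj => hw j (hj.trans k.le_succ)
    have h2 := hw (k + 1) le_rfl
    have h3 := hα (k + 1)
    have h4 := hα1 (k + 1)
    calc ‖average α w (k + 1)‖
        ≤ ‖(1 - α (k + 1)) • average α w k‖ + ‖α (k + 1) • w (k + 1)‖ := norm_add_le _ _
      _ = (1 - α (k + 1)) * ‖average α w k‖ + α (k + 1) * ‖w (k + 1)‖ := by
        rw [norm_smul, norm_smul, Real.norm_of_nonneg (by linarith), Real.norm_of_nonneg h3]
      _ ≤ (1 - α (k + 1)) * B + α (k + 1) * B := by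
        have : 0 ≤ 1 - α (k + 1) := by linarith
        gcongr
      _ = B := by ring

/-- The drift of `u` makes its running average lag behind `u` by a controlled amount. -/
lemma sum_norm_average_sub_sq_le {u v : ℕ → E} {β p : ℝ} (hβ : 0 < β) (hα : ∀ k, β ≤ α k)
    (hα1 : ∀ k, α k ≤ 1) (K : ℕ) (hu : ∀ k < K, ‖u (k + 1) - u k‖ ≤ p * ‖v k‖) :
    β * ∑ k ∈ Finset.range K, ‖average α u k - u k‖ ^ 2 + ‖average α u K - u K‖ ^ 2 ≤
      p ^ 2 / β * ∑ k ∈ Finset.range K, ‖v k‖ ^ 2 := by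
  induction K with
  | zero => simp [average]
  | succ K ih =>
    rw [Finset.sum_range_succ, Finset.sum_range_succ]
    have ih' := ih fun k hk => hu k (hk.trans K.lt_succ_self)
    have h1 := hα (K + 1)
    have h2 := hα1 (K + 1)
    have hrec : average α u (K + 1) - u (K + 1) =
        (1 - α (K + 1)) • ((average α u K - u K) - (u (K + 1) - u K)) := by
      simp only [average]; module
    set x := ‖average α u K - u K‖
    set y := ‖u (K + 1) - u K‖
    have hy : y ^ 2 ≤ p ^ 2 * ‖v K‖ ^ 2 := by
      rw [← mul_pow]; exact pow_le_pow_left₀ (norm_nonneg _) (hu K K.lt_succ_self) 2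
    have hx0 : 0 ≤ x := norm_nonneg _
    have hy0 : 0 ≤ y := norm_nonneg _
    have hnorm : ‖average α u (K + 1) - u (K + 1)‖ ≤ (1 - β) * (x + y) := by
      rw [hrec, norm_smul, Real.norm_of_nonneg (by linarith)]
      exact mul_le_mul (by linarith) (norm_sub_le _ _) (norm_nonneg _) (by linarith)
    have hsq : ‖average α u (K + 1) - u (K + 1)‖ ^ 2 ≤ ((1 - β) * (x + y)) ^ 2 :=
      pow_le_pow_left₀ (norm_nonneg _) hnorm 2
    -- Young's inequality with parameter `β`: one factor `1 - β` pays for the cross term, the other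
    -- survives and produces the sum on the left.
    have hstep : ((1 - β) * (x + y)) ^ 2 ≤ (1 - β) * x ^ 2 + y ^ 2 / β := by
      rw [← sub_le_iff_le_add', le_div_iff₀ hβ]
      have hc : 0 ≤ 1 - β := by linarith
      nlinarith [mul_nonneg hc (sq_nonneg (β * x - (1 - β) * y)),
        mul_nonneg (mul_nonneg hβ.le (by linarith : 0 ≤ 2 - β)) (sq_nonneg y)]
    have hdiv : y ^ 2 / β ≤ p ^ 2 / β * ‖v K‖ ^ 2 := by
      rw [div_mul_eq_mul_div]; gcongr
    linarith

/-- Summing squares of averages of bounded noise: only the cross terms are random. -/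
lemma sum_norm_average_sq_le {n : ℕ → E} {β σ : ℝ} (hβ : 0 < β) (hα : ∀ k, β ≤ α k)
    (hα1 : ∀ k, α k ≤ 1) (hn : ∀ k, ‖n k‖ ≤ σ) (K : ℕ) :
    β * ∑ k ∈ Finset.range K, ‖average α n k‖ ^ 2 + ‖average α n K‖ ^ 2 ≤
      σ ^ 2 + ∑ k ∈ Finset.range K,
        2 * α (k + 1) * (1 - α (k + 1)) * inner ℝ (average α n k) (n (k + 1)) +
      σ ^ 2 * ∑ k ∈ Finset.range K, α (k + 1) ^ 2 := by
  induction K with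
  | zero =>
    simpa [average] using pow_le_pow_left₀ (norm_nonneg _) (hn 0) 2
  | succ K ih =>
    rw [Finset.sum_range_succ, Finset.sum_range_succ, Finset.sum_range_succ]
    have h1 := hα (K + 1)
    have h2 := hα1 (K + 1)
    have hexp : ‖average α n (K + 1)‖ ^ 2 = (1 - α (K + 1)) ^ 2 * ‖average α n K‖ ^ 2 +
        2 * α (K + 1) * (1 - α (K + 1)) * inner ℝ (average α n K) (n (K + 1)) +
        α (K + 1) ^ 2 * ‖n (K + 1)‖ ^ 2 := by
      simp only [average]
      rw [norm_add_sq_real, norm_smul, norm_smul, mul_pow, mul_pow, inner_smul_left,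
        inner_smul_right, Real.norm_eq_abs, Real.norm_eq_abs, sq_abs, sq_abs]
      simp only [conj_trivial]
      ring
    have hσ : ‖n (K + 1)‖ ^ 2 ≤ σ ^ 2 := pow_le_pow_left₀ (norm_nonneg _) (hn _) 2
    have h3 : α (K + 1) ^ 2 * ‖n (K + 1)‖ ^ 2 ≤ α (K + 1) ^ 2 * σ ^ 2 := by gcongr
    have h4 : (1 - α (K + 1)) ^ 2 * ‖average α n K‖ ^ 2 ≤ (1 - β) * ‖average α n K‖ ^ 2 := by
      gcongr
      nlinarith
    rw [hexp]
    linarith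

/-- The descent inequalities, summed up: the lag of the momentum is absorbed. -/
lemma descent_sum {u n : ℕ → E} {F : ℕ → ℝ} {β p q a A : ℝ} (hβ : 0 < β) (hα : ∀ k, β ≤ α k)
    (hα1 : ∀ k, α k ≤ 1) (hp : 0 ≤ p) (hpq : p ≤ q * β) (hA : 0 ≤ A) (hq : 6 * q ^ 2 ≤ 1)
    (hqA : 24 * q ^ 2 * A ≤ a) (K : ℕ)
    (hu : ∀ k < K, ‖u (k + 1) - u k‖ ≤ p * ‖average α (fun j => u j + n j) k‖)
    (hF : ∀ k < K, F (k + 1) ≤ F k - a * ‖u k‖ ^ 2 +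
      A * ‖average α (fun j => u j + n j) k - u k‖ ^ 2) :
    F K + a / 2 * ∑ k ∈ Finset.range K, ‖u k‖ ^ 2 ≤
      F 0 + 4 * A * ∑ k ∈ Finset.range K, ‖average α n k‖ ^ 2 := by
  set U := ∑ k ∈ Finset.range K, ‖u k‖ ^ 2 with hU
  set S := ∑ k ∈ Finset.range K, ‖average α n k‖ ^ 2 with hS
  set b : ℕ → E := fun k => average α u k - u k with hb
  set R := ∑ k ∈ Finset.range K, ‖b k‖ ^ 2 with hR
  set M := ∑ k ∈ Finset.range K, ‖average α (fun j => u j + n j) k‖ ^ 2 with hM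
  have hU0 : 0 ≤ U := Finset.sum_nonneg fun _ _ => sq_nonneg _
  have hS0 : 0 ≤ S := Finset.sum_nonneg fun _ _ => sq_nonneg _
  have hR0 : 0 ≤ R := Finset.sum_nonneg fun _ _ => sq_nonneg _
  have hM0 : 0 ≤ M := Finset.sum_nonneg fun _ _ => sq_nonneg _
  have hdec : ∀ k, average α (fun j => u j + n j) k = u k + average α n k + b k := by
    intro k; rw [average_add]; simp only [hb]; abel
  have hMle : M ≤ 3 * U + 3 * S + 3 * R := by
    rw [hM, hU, hS, hR, Finset.mul_sum, Finset.mul_sum, Finset.mul_sum, ← Finset.sum_add_distrib,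
      ← Finset.sum_add_distrib]
    refine Finset.sum_le_sum fun k _ => ?_
    rw [hdec k]
    have := pow_le_pow_left₀ (norm_nonneg _) (norm_add₃_le (a := u k) (b := average α n k) (c := b k)) 2
    nlinarith [sq_nonneg (‖u k‖ - ‖average α n k‖), sq_nonneg (‖u k‖ - ‖b k‖),
      sq_nonneg (‖average α n k‖ - ‖b k‖)]
  have hRM : R ≤ q ^ 2 * M := by
    have h1 := sum_norm_average_sub_sq_le hβ hα hα1 K hu
    have h2 : β * R ≤ p ^ 2 / β * M := (le_add_of_nonneg_right (sq_nonneg _)).trans h1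
    have h3 : p ^ 2 / β * M ≤ (q * β) ^ 2 / β * M := by gcongr
    have h4 : (q * β) ^ 2 / β * M = β * (q ^ 2 * M) := by field_simp
    exact le_of_mul_le_mul_left (by linarith) hβ
  -- The momentum contains the lag itself, so `R` occurs on both sides; `3 * q ^ 2 ≤ 1 / 2` moves it
  -- to the left.
  have hRle : R ≤ 6 * q ^ 2 * (U + S) := by
    have h1 : q ^ 2 * M ≤ q ^ 2 * (3 * U + 3 * S + 3 * R) := by gcongr
    nlinarith [mul_le_mul_of_nonneg_right hq hR0]
  have htel : F K ≤ F 0 - a * U + A * ∑ k ∈ Finset.range K,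
      ‖average α (fun j => u j + n j) k - u k‖ ^ 2 := by
    rw [hU, Finset.mul_sum, Finset.mul_sum, sub_add, ← Finset.sum_sub_distrib]
    have h := Finset.sum_le_sum (s := Finset.range K)
      (f := fun k => F (k + 1) - F k)
      (g := fun k => -(a * ‖u k‖ ^ 2 - A * ‖average α (fun j => u j + n j) k - u k‖ ^ 2))
      (fun k hk => by linarith [hF k (Finset.mem_range.1 hk)])
    rw [Finset.sum_range_sub, Finset.sum_neg_distrib] at h
    linarith
  have herr : ∑ k ∈ Finset.range K, ‖average α (fun j => u j + n j) k - u k‖ ^ 2 ≤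
      2 * S + 2 * R := by
    rw [hS, hR, Finset.mul_sum, Finset.mul_sum, ← Finset.sum_add_distrib]
    refine Finset.sum_le_sum fun k _ => ?_
    rw [hdec k, add_assoc, add_sub_cancel_left]
    have := pow_le_pow_left₀ (norm_nonneg _) (norm_add_le (average α n k) (b k)) 2
    nlinarith [sq_nonneg (‖average α n k‖ - ‖b k‖)]
  have h1 : A * ∑ k ∈ Finset.range K, ‖average α (fun j => u j + n j) k - u k‖ ^ 2 ≤
      A * (2 * S + 2 * (6 * q ^ 2 * (U + S))) := by
    gcongr; linarith
  have h2 : 24 * q ^ 2 * A * U ≤ a * U := by gcongr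
  have h3 : 6 * q ^ 2 * (A * S) ≤ 1 * (A * S) := by gcongr
  linarith

end average

/-! ### One run of Adam -/

section run

variable {d : ℕ} {Ξ : Type*} {g : Vec d → Ξ → Vec d} {β βsq η lam : ℝ} {xinit : Vec d} {ξ : ℕ → Ξ}

/-- The stochastic gradient used in iteration `k + 1`. -/
noncomputable def sgrad (g : Vec d → Ξ → Vec d) (β βsq η lam : ℝ) (xinit : Vec d) (ξ : ℕ → Ξ) (k : ℕ) : Vec d :=
  g (run g β βsq η lam xinit ξ k).x (ξ (k + 1))

/-- Raw momentum is the normalizing factor times an average: `one_sub_weight_mul` is the matching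
recursion of the factors. The first weight is `1`, so the zero initialization leaves no trace. -/
lemma run_m (hβ : 0 < β) (hβ1 : β ≤ 1) (k : ℕ) :
    (run g β βsq η lam xinit ξ (k + 1)).m =
      (1 - (1 - β) ^ (k + 1)) • average (weight β) (sgrad g β βsq η lam xinit ξ) k := by
  induction k with
  | zero => simp [run, step, average, sgrad]
  | succ k ih =>
    have h : (run g β βsq η lam xinit ξ (k + 1 + 1)).m =
        (1 - β) • (run g β βsq η lam xinit ξ (k + 1)).m +
          β • sgrad g β βsq η lam xinit ξ (k + 1) := rfl
    have hw : (1 - (1 - β) ^ (k + 1 + 1)) * weight β (k + 1) = β := by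
      rw [weight, mul_div_cancel₀ _ (one_sub_pow_pos hβ hβ1 (k + 1)).ne']
    rw [h, ih, average, smul_add, smul_smul, smul_smul, smul_smul, hw,
      ← one_sub_weight_mul hβ hβ1 k]

lemma run_v_bounds (hβsq : 0 ≤ βsq) (hβsq1 : βsq ≤ 1) {B : ℝ} (k : ℕ)
    (hB : ∀ j < k, ‖sgrad g β βsq η lam xinit ξ j‖ ≤ B) (i : Fin d) :
    0 ≤ (run g β βsq η lam xinit ξ k).v i ∧
      (run g β βsq η lam xinit ξ k).v i ≤ (1 - (1 - βsq) ^ k) * B ^ 2 := by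
  induction k with
  | zero => simp [run]
  | succ k ih =>
    obtain ⟨h0, h1⟩ := ih fun j hj => hB j (hj.trans k.lt_succ_self)
    have h : (run g β βsq η lam xinit ξ (k + 1)).v i =
        (1 - βsq) * (run g β βsq η lam xinit ξ k).v i +
          βsq * (sgrad g β βsq η lam xinit ξ k i) ^ 2 := rfl
    have hc : 0 ≤ 1 - βsq := by linarith
    have hi : (sgrad g β βsq η lam xinit ξ k i) ^ 2 ≤ B ^ 2 := by
      rw [← sq_abs, ← Real.norm_eq_abs]
      exact pow_le_pow_left₀ (norm_nonneg _)
        ((PiLp.norm_apply_le _ i).trans (hB k k.lt_succ_self)) 2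
    rw [h]
    refine ⟨by positivity, ?_⟩
    calc _ ≤ (1 - βsq) * ((1 - (1 - βsq) ^ k) * B ^ 2) + βsq * B ^ 2 := by gcongr
      _ = _ := by ring

/-- The corrected second momentum is an average of squared coordinates, each at most `B ^ 2`. These
bounds on the stepsize are all that the analysis uses about it, so `βsq` is arbitrary. -/
lemma run_x_succ (hβ : 0 < β) (hβ1 : β ≤ 1) (hβsq : 0 ≤ βsq) (hβsq1 : βsq ≤ 1) (hη : 0 < η)
    (hlam : 0 < lam) {B : ℝ} (hB0 : 0 ≤ B) (k : ℕ)
    (hB : ∀ j ≤ k, ‖sgrad g β βsq η lam xinit ξ j‖ ≤ B) (i : Fin d) :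
    ∃ h : ℝ, η / (B + lam) ≤ h ∧ h ≤ η / lam ∧
      (run g β βsq η lam xinit ξ (k + 1)).x i = (run g β βsq η lam xinit ξ k).x i -
        h * average (weight β) (sgrad g β βsq η lam xinit ξ) k i := by
  set vhat : ℝ := (run g β βsq η lam xinit ξ (k + 1)).v i / (1 - (1 - βsq) ^ (k + 1)) with hv
  have hx : (run g β βsq η lam xinit ξ (k + 1)).x i = (run g β βsq η lam xinit ξ k).x i -
      η / (Real.sqrt vhat + lam) *
        ((run g β βsq η lam xinit ξ (k + 1)).m i / (1 - (1 - β) ^ (k + 1))) := rfl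
  have hm : (run g β βsq η lam xinit ξ (k + 1)).m i / (1 - (1 - β) ^ (k + 1)) =
      average (weight β) (sgrad g β βsq η lam xinit ξ) k i := by
    rw [run_m hβ hβ1 k, PiLp.smul_apply, smul_eq_mul,
      mul_div_cancel_left₀ _ (one_sub_pow_pos hβ hβ1 k).ne']
  have hsqrt : Real.sqrt vhat ≤ B := by
    obtain ⟨-, h1⟩ := run_v_bounds (g := g) (β := β) (η := η) (lam := lam) (xinit := xinit)
      (ξ := ξ) hβsq hβsq1 (k + 1) (fun j hj => hB j (Nat.lt_succ_iff.1 hj)) i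
    have hp : 0 ≤ 1 - (1 - βsq) ^ (k + 1) :=
      sub_nonneg.2 (pow_le_one₀ (by linarith) (by linarith))
    refine Real.sqrt_le_iff.2 ⟨hB0, ?_⟩
    rw [hv]
    -- For `βsq = 0` the denominator is `0` and the quotient is `0`; a nonnegative denominator
    -- suffices here.
    exact div_le_of_le_mul₀ hp (sq_nonneg _) (by linarith)
  have hs0 := Real.sqrt_nonneg vhat
  refine ⟨η / (Real.sqrt vhat + lam), ?_, ?_, by rw [hx, hm]⟩
  · gcongr
  · gcongr
    linarith

/-- The effect of a preconditioned step on the quadratic model of the objective. -/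
lemma preconditioned_step {x y u m : Vec d} {h : Fin d → ℝ} {lo hi L : ℝ} (hL : 0 ≤ L)
    (hlo : ∀ i, lo ≤ h i) (hlo0 : 0 ≤ lo) (hhi : ∀ i, h i ≤ hi) (hLhi : L * hi ≤ 1 / 8)
    (hy : ∀ i, y i = x i - h i * m i) :
    ‖y - x‖ ≤ hi * ‖m‖ ∧
      inner ℝ u (y - x) + L * ‖y - x‖ ^ 2 ≤ -(lo / 4) * ‖u‖ ^ 2 + hi * ‖m - u‖ ^ 2 := by
  have hyx : ∀ i, (y - x) i = -(h i * m i) := fun i => by rw [PiLp.sub_apply, hy]; ring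
  constructor
  -- Without coordinates nothing forces `hi` to be nonnegative.
  · rcases isEmpty_or_nonempty (Fin d) with hd | ⟨⟨i₀⟩⟩
    · have h1 : y - x = 0 := Subsingleton.elim _ _
      have h2 : m = 0 := Subsingleton.elim _ _
      simp [h1, h2]
    have hhi0 : 0 ≤ hi := hlo0.trans ((hlo i₀).trans (hhi i₀))
    refine le_of_sq_le_sq ?_ (by positivity)
    rw [mul_pow, EuclideanSpace.real_norm_sq_eq, EuclideanSpace.real_norm_sq_eq, Finset.mul_sum]
    refine Finset.sum_le_sum fun i _ => ?_
    rw [hyx, neg_sq, mul_pow]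
    have := hlo0.trans (hlo i)
    gcongr
    exact hhi i
  · rw [EuclideanSpace.real_norm_sq_eq, EuclideanSpace.real_norm_sq_eq,
      EuclideanSpace.real_norm_sq_eq, PiLp.inner_apply, Finset.mul_sum, Finset.mul_sum,
      Finset.mul_sum, ← Finset.sum_add_distrib, ← Finset.sum_add_distrib]
    refine Finset.sum_le_sum fun i _ => ?_
    rw [hyx, PiLp.sub_apply]
    simp only [RCLike.inner_apply, conj_trivial]
    have hi0 := hlo0.trans (hlo i)
    have h1 : L * h i ≤ 1 / 8 := (mul_le_mul_of_nonneg_left (hhi i) hL).trans hLhi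
    set e := m i - u i with he
    have hm : m i = u i + e := by rw [he]; ring
    rw [hm]
    have h2 : L * (-(h i * (u i + e))) ^ 2 ≤ 1 / 8 * (h i * (u i + e) ^ 2) := by
      have := mul_le_mul_of_nonneg_right h1 (by positivity : 0 ≤ h i * (u i + e) ^ 2)
      linarith
    have h3 : -(h i * (u i + e)) * u i + 1 / 8 * (h i * (u i + e) ^ 2) ≤
        h i * (-(1 / 4) * u i ^ 2 + e ^ 2) := by
      have : 0 ≤ h i * (-(1 / 4) * u i ^ 2 + e ^ 2 + (u i + e) * u i - 1 / 8 * (u i + e) ^ 2) :=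
        mul_nonneg hi0 (by nlinarith [sq_nonneg (u i + e), sq_nonneg (u i + 2 * e)])
      linarith
    have h4 : lo * u i ^ 2 ≤ h i * u i ^ 2 := by gcongr; exact hlo i
    have h5 : h i * e ^ 2 ≤ hi * e ^ 2 := by gcongr; exact hhi i
    linarith

end run

/-! ### Concentration -/

section azuma

variable {Ω : Type*} {m0 : MeasurableSpace Ω} {μ : Measure Ω} [IsProbabilityMeasure μ]
  {ℱ : Filtration ℕ m0} {Y : ℕ → Ω → ℝ} {c : ℕ → ℝ}

lemma stronglyMeasurable_sum_range (hY : ∀ k, StronglyMeasurable[ℱ (k + 1)] (Y k)) (n : ℕ) :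
    StronglyMeasurable[ℱ n] fun ω => ∑ k ∈ Finset.range n, Y k ω :=
  Finset.stronglyMeasurable_fun_sum _ fun k hk =>
    (hY k).mono (ℱ.mono (Finset.mem_range.1 hk))

lemma integrable_exp_sum (hY : ∀ k, StronglyMeasurable[ℱ (k + 1)] (Y k))
    (hc : ∀ k, ∀ᵐ ω ∂μ, |Y k ω| ≤ c k) (θ : ℝ) (n : ℕ) :
    Integrable (fun ω => Real.exp (θ * ∑ k ∈ Finset.range n, Y k ω)) μ := by
  have hm : StronglyMeasurable[ℱ n] fun ω => Real.exp (θ * ∑ k ∈ Finset.range n, Y k ω) :=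
    Real.continuous_exp.comp_stronglyMeasurable
      ((stronglyMeasurable_sum_range hY n).const_mul θ)
  refine Integrable.of_bound (hm.mono (ℱ.le n)).aestronglyMeasurable
    (Real.exp (|θ| * ∑ k ∈ Finset.range n, c k)) ?_
  filter_upwards [ae_all_iff.2 hc] with ω hω
  rw [Real.norm_eq_abs, Real.abs_exp]
  refine Real.exp_le_exp.2 ((le_abs_self _).trans ?_)
  rw [abs_mul]
  gcongr
  exact (Finset.abs_sum_le_sum_abs _ _).trans (Finset.sum_le_sum fun k _ => hω k)

/-- Convexity puts the exponential of the last increment below its chord on `[-c n, c n]`. The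
linear part integrates to zero because the past factor is `ℱ n`-measurable, and `cosh x ≤ exp (x ^ 2
/ 2)` bounds the rest. -/
lemma integral_exp_sum_le (hY : ∀ k, StronglyMeasurable[ℱ (k + 1)] (Y k))
    (hc : ∀ k, ∀ᵐ ω ∂μ, |Y k ω| ≤ c k) (h0 : ∀ k, μ[Y k | ℱ k] =ᵐ[μ] 0) (θ : ℝ) (n : ℕ) :
    ∫ ω, Real.exp (θ * ∑ k ∈ Finset.range n, Y k ω) ∂μ ≤
      Real.exp (θ ^ 2 / 2 * ∑ k ∈ Finset.range n, c k ^ 2) := by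
  induction n with
  | zero => simp
  | succ n ih =>
    set Z : Ω → ℝ := fun ω => Real.exp (θ * ∑ k ∈ Finset.range n, Y k ω) with hZ
    have hZi : Integrable Z μ := integrable_exp_sum hY hc θ n
    have hZm : StronglyMeasurable[ℱ n] Z :=
      Real.continuous_exp.comp_stronglyMeasurable
        ((stronglyMeasurable_sum_range hY n).const_mul θ)
    have hYm : AEStronglyMeasurable (Y n) μ := ((hY n).mono (ℱ.le _)).aestronglyMeasurable
    have hYi : Integrable (Y n) μ := Integrable.of_bound hYm (c n) (by simpa using hc n)
    have hZY : Integrable (fun ω => Z ω * Y n ω) μ := hZi.mul_bdd (c := c n) hYm (by simpa using hc n)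
    have hzero : ∫ ω, Z ω * Y n ω ∂μ = 0 := by
      have h1 : μ[Z * Y n | ℱ n] =ᵐ[μ] 0 := by
        filter_upwards [condExp_mul_of_stronglyMeasurable_left hZm hZY hYi, h0 n] with ω h2 h3
        simp [h2, h3]
      rw [← show ∫ ω, (Z * Y n) ω ∂μ = ∫ ω, Z ω * Y n ω ∂μ from rfl,
        ← integral_condExp (ℱ.le n), integral_congr_ae h1]
      simp
    have hpt : ∀ᵐ ω ∂μ, Real.exp (θ * ∑ k ∈ Finset.range (n + 1), Y k ω) ≤
        Real.cosh (θ * c n) * Z ω + Real.sinh (θ * c n) / c n * (Z ω * Y n ω) := by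
      filter_upwards [hc n] with ω hω
      rw [Finset.sum_range_succ, mul_add, Real.exp_add]
      have hcn : 0 ≤ c n := (abs_nonneg _).trans hω
      have key : Real.exp (θ * Y n ω) ≤
          Real.cosh (θ * c n) + Y n ω / c n * Real.sinh (θ * c n) := by
        rcases hcn.eq_or_lt with h | h
        · rw [← h] at hω ⊢
          have : Y n ω = 0 := abs_nonpos_iff.1 hω
          simp [this]
        · have hle : |Y n ω / c n| ≤ 1 := by
            rw [abs_div, abs_of_pos h]; exact (div_le_one h).2 hω
          have := Real.exp_mul_le_cosh_add_mul_sinh hle (θ * c n)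
          rwa [show Y n ω / c n * (θ * c n) = θ * Y n ω by field_simp] at this
      calc Z ω * Real.exp (θ * Y n ω)
          ≤ Z ω * (Real.cosh (θ * c n) + Y n ω / c n * Real.sinh (θ * c n)) :=
            mul_le_mul_of_nonneg_left key (Real.exp_pos _).le
        _ = _ := by ring
    calc ∫ ω, Real.exp (θ * ∑ k ∈ Finset.range (n + 1), Y k ω) ∂μ
        ≤ ∫ ω, (Real.cosh (θ * c n) * Z ω + Real.sinh (θ * c n) / c n * (Z ω * Y n ω)) ∂μ :=
          integral_mono_ae (integrable_exp_sum hY hc θ (n + 1))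
            ((hZi.const_mul _).add (hZY.const_mul _)) hpt
      _ = Real.cosh (θ * c n) * ∫ ω, Z ω ∂μ := by
        rw [integral_add (hZi.const_mul _) (hZY.const_mul _), integral_const_mul,
          integral_const_mul, hzero, mul_zero, add_zero]
      _ ≤ Real.exp ((θ * c n) ^ 2 / 2) *
          Real.exp (θ ^ 2 / 2 * ∑ k ∈ Finset.range n, c k ^ 2) := by
        gcongr
        exact Real.cosh_le_exp_half_sq _
      _ = _ := by
        rw [← Real.exp_add, Finset.sum_range_succ]
        ring_nf

/-- The Azuma–Hoeffding inequality. -/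
lemma measure_lt_sum_le (hY : ∀ k, StronglyMeasurable[ℱ (k + 1)] (Y k))
    (hc : ∀ k, ∀ᵐ ω ∂μ, |Y k ω| ≤ c k) (h0 : ∀ k, μ[Y k | ℱ k] =ᵐ[μ] 0) {n : ℕ} {V ι s : ℝ}
    (hV : ∑ k ∈ Finset.range n, c k ^ 2 ≤ V) (hs : 0 ≤ s) (hsV : 2 * V * ι ≤ s ^ 2) :
    μ {ω | s < ∑ k ∈ Finset.range n, Y k ω} ≤ ENNReal.ofReal (Real.exp (-ι)) := by
  have hV0 : 0 ≤ V := (Finset.sum_nonneg fun _ _ => sq_nonneg _).trans hV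
  rcases hV0.eq_or_lt with rfl | hVpos
  · have hck : ∀ k ∈ Finset.range n, c k = 0 := by
      intro k hk
      have h1 := Finset.single_le_sum (f := fun k => c k ^ 2) (fun _ _ => sq_nonneg _) hk
      exact pow_eq_zero_iff two_ne_zero |>.1 (le_antisymm (h1.trans hV) (sq_nonneg _))
    have hzero : μ {ω | s < ∑ k ∈ Finset.range n, Y k ω} = 0 := by
      refine measure_mono_null ?_ (ae_iff.1 (ae_all_iff.2 hc))
      intro ω hω hcon
      refine absurd (show s < _ from hω) (not_lt.2 ?_)
      refine (Finset.sum_nonpos fun k hk => ?_).trans hs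
      have := hcon k
      rw [hck k hk] at this
      exact (le_abs_self _).trans this
    simp [hzero]
  -- The minimizer of `θ ^ 2 * V / 2 - θ * s`, with minimum `-s ^ 2 / (2 * V) ≤ -ι`.
  · set θ : ℝ := s / V with hθ
    have hθ0 : 0 ≤ θ := by positivity
    have hint := integrable_exp_sum (μ := μ) hY hc θ n
    have hmgf := integral_exp_sum_le hY hc h0 θ n
    have hmarkov := mul_meas_ge_le_integral_of_nonneg (μ := μ)
      (f := fun ω => Real.exp (θ * ∑ k ∈ Finset.range n, Y k ω))
      (ae_of_all _ fun ω => (Real.exp_pos _).le) hint (Real.exp (θ * s))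
    have hsub : {ω | s < ∑ k ∈ Finset.range n, Y k ω} ⊆
        {ω | Real.exp (θ * s) ≤ Real.exp (θ * ∑ k ∈ Finset.range n, Y k ω)} := by
      intro ω hω
      exact Real.exp_le_exp.2 (mul_le_mul_of_nonneg_left (le_of_lt hω) hθ0)
    refine (measure_mono hsub).trans ?_
    rw [← ENNReal.ofReal_toReal (measure_ne_top μ
      {ω | Real.exp (θ * s) ≤ Real.exp (θ * ∑ k ∈ Finset.range n, Y k ω)})]
    refine ENNReal.ofReal_le_ofReal ?_
    have h1 : Real.exp (θ ^ 2 / 2 * ∑ k ∈ Finset.range n, c k ^ 2) ≤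
        Real.exp (θ * s) * Real.exp (-ι) := by
      rw [← Real.exp_add]
      refine Real.exp_le_exp.2 ?_
      have h2 : θ ^ 2 / 2 * ∑ k ∈ Finset.range n, c k ^ 2 ≤ θ ^ 2 / 2 * V := by gcongr
      have h3 : θ ^ 2 / 2 * V = θ * s / 2 := by rw [hθ]; field_simp
      have h4 : ι ≤ θ * s / 2 := by
        rw [hθ, div_mul_eq_mul_div, div_div, le_div_iff₀ (by positivity)]
        linarith
      linarith
    exact le_of_mul_le_mul_left ((hmarkov.trans hmgf).trans h1) (Real.exp_pos _)

end azuma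

/-! ### The noise process -/

section crossTerm

variable {d : ℕ} {Ξ : Type*} {f : Vec d → ℝ} {g : Vec d → Ξ → Vec d} {β βsq η lam σ : ℝ}
  {xinit : Vec d} {ξ : ℕ → Ξ}

/-- The error of the stochastic gradient used in iteration `k + 1`. -/
noncomputable def noise (f : Vec d → ℝ) (g : Vec d → Ξ → Vec d)
    (β βsq η lam : ℝ) (xinit : Vec d) (ξ : ℕ → Ξ) (k : ℕ) : Vec d :=
  sgrad g β βsq η lam xinit ξ k - gradient f (run g β βsq η lam xinit ξ k).x

/-- The cross terms in the expansion of the averaged noise. -/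
noncomputable def crossTerm (f : Vec d → ℝ) (g : Vec d → Ξ → Vec d)
    (β βsq η lam : ℝ) (xinit : Vec d) (ξ : ℕ → Ξ) (k : ℕ) : ℝ :=
  2 * weight β (k + 1) * (1 - weight β (k + 1)) *
    inner ℝ (average (weight β) (noise f g β βsq η lam xinit ξ) k)
      (noise f g β βsq η lam xinit ξ (k + 1))

lemma abs_crossTerm_le (hβ : 0 < β) (hβ1 : β ≤ 1)
    (hn : ∀ k, ‖noise f g β βsq η lam xinit ξ k‖ ≤ σ) (k : ℕ) :
    |crossTerm f g β βsq η lam xinit ξ k| ≤ 2 * weight β (k + 1) * σ ^ 2 := by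
  have hw0 : ∀ k, 0 ≤ weight β k := fun k => hβ.le.trans (le_weight hβ hβ1 k)
  have hw1 := weight_le_one hβ hβ1
  have hσ : 0 ≤ σ := (norm_nonneg _).trans (hn 0)
  have h1 := norm_average_le hw0 hw1 k fun j _ => hn j
  have h2 : |inner ℝ (average (weight β) (noise f g β βsq η lam xinit ξ) k)
      (noise f g β βsq η lam xinit ξ (k + 1))| ≤ σ ^ 2 := by
    rw [pow_two]
    exact (abs_real_inner_le_norm _ _).trans (mul_le_mul h1 (hn _) (norm_nonneg _) hσ)
  have hw := hw0 (k + 1)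
  have hw' : 0 ≤ 1 - weight β (k + 1) := by linarith [hw1 (k + 1)]
  rw [crossTerm, abs_mul, abs_mul, abs_of_nonneg hw', abs_of_nonneg (by positivity)]
  refine mul_le_mul ?_ h2 (abs_nonneg _) (by positivity)
  exact mul_le_of_le_one_right (by positivity) (by linarith)

end crossTerm

section noise

variable {d : ℕ} {Ω Ξ : Type*} [MeasurableSpace Ξ] {f : Vec d → ℝ} {g : Vec d → Ξ → Vec d}
  {β βsq η lam σ : ℝ} {xinit : Vec d} {ξ : ℕ → Ω → Ξ}

lemma measurable_gradient (f : Vec d → ℝ) : Measurable (gradient f) :=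
  (InnerProductSpace.toDual ℝ (Vec d)).symm.continuous.measurable.comp (measurable_fderiv ℝ f)

lemma measurable_toLp_of_apply [MeasurableSpace Ω] {h : Ω → Fin d → ℝ}
    (hh : ∀ i, Measurable fun ω => h ω i) : Measurable fun ω => (WithLp.toLp 2 (h ω) : Vec d) :=
  (WithLp.measurable_toLp 2 _).comp (measurable_pi_iff.2 hh)

lemma measurable_vec_apply [MeasurableSpace Ω] {h : Ω → Vec d} (hh : Measurable h) (i : Fin d) :
    Measurable fun ω => h ω i :=
  (measurable_pi_apply i).comp ((WithLp.measurable_ofLp 2 _).comp hh)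

/-- The σ-algebra on `Ω` is arbitrary and only the samples used so far must be measurable. With
`past` in its place this gives adaptedness. -/
lemma measurable_run [MeasurableSpace Ω] (hg : Measurable fun p : Vec d × Ξ => g p.1 p.2) (k : ℕ)
    (hξ : ∀ s, 1 ≤ s → s ≤ k → Measurable (ξ s)) :
    Measurable (fun ω => (run g β βsq η lam xinit (fun s => ξ s ω) k).x) ∧
    Measurable (fun ω => (run g β βsq η lam xinit (fun s => ξ s ω) k).m) ∧
    Measurable (fun ω => (run g β βsq η lam xinit (fun s => ξ s ω) k).v) := by
  induction k with
  | zero => exact ⟨measurable_const, measurable_const, measurable_const⟩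
  | succ k ih =>
    obtain ⟨hx, hm, hv⟩ := ih fun s h1 h2 => hξ s h1 (h2.trans k.le_succ)
    have hgrad : Measurable fun ω =>
        g (run g β βsq η lam xinit (fun s => ξ s ω) k).x (ξ (k + 1) ω) :=
      hg.comp (hx.prodMk (hξ (k + 1) (by omega) le_rfl))
    have hm' : Measurable fun ω => (run g β βsq η lam xinit (fun s => ξ s ω) (k + 1)).m :=
      (hm.const_smul (1 - β)).add (hgrad.const_smul β)
    have hv' : Measurable fun ω => (run g β βsq η lam xinit (fun s => ξ s ω) (k + 1)).v :=
      measurable_toLp_of_apply fun i => ((measurable_vec_apply hv i).const_mul _).add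
        (((measurable_vec_apply hgrad i).pow_const 2).const_mul _)
    refine ⟨measurable_toLp_of_apply fun i => ?_, hm', hv'⟩
    exact (measurable_vec_apply hx i).sub ((measurable_const.div
      ((((measurable_vec_apply hv' i).div_const _).sqrt).add_const lam)).mul
      ((measurable_vec_apply hm' i).div_const _))

lemma measurable_sgrad [MeasurableSpace Ω] (hg : Measurable fun p : Vec d × Ξ => g p.1 p.2) (k : ℕ)
    (hξ : ∀ s, 1 ≤ s → s ≤ k + 1 → Measurable (ξ s)) :
    Measurable fun ω => sgrad g β βsq η lam xinit (fun s => ξ s ω) k :=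
  hg.comp ((measurable_run hg k fun s h1 h2 => hξ s h1 (by omega)).1.prodMk
    (hξ (k + 1) (by omega) le_rfl))

lemma measurable_noise [MeasurableSpace Ω] (hg : Measurable fun p : Vec d × Ξ => g p.1 p.2) (k : ℕ)
    (hξ : ∀ s, 1 ≤ s → s ≤ k + 1 → Measurable (ξ s)) :
    Measurable fun ω => noise f g β βsq η lam xinit (fun s => ξ s ω) k :=
  (measurable_sgrad hg k hξ).sub ((measurable_gradient f).comp
    (measurable_run hg k fun s h1 h2 => hξ s h1 (by omega)).1)

lemma measurable_average_noise [MeasurableSpace Ω]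
    (hg : Measurable fun p : Vec d × Ξ => g p.1 p.2) (α : ℕ → ℝ) (k : ℕ)
    (hξ : ∀ s, 1 ≤ s → s ≤ k + 1 → Measurable (ξ s)) :
    Measurable fun ω => average α (noise f g β βsq η lam xinit fun s => ξ s ω) k := by
  induction k with
  | zero => exact measurable_noise hg 0 hξ
  | succ k ih =>
    exact ((ih fun s h1 h2 => hξ s h1 (by omega)).const_smul (1 - α (k + 1))).add
      ((measurable_noise hg (k + 1) hξ).const_smul (α (k + 1)))

lemma measurable_past {s t : ℕ} (hs : 1 ≤ s) (hst : s < t) : Measurable[past ξ t] (ξ s) :=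
  measurable_iff_comap_le.2
    (le_iSup₂_of_le (f := fun s (_ : s ∈ {s : ℕ | 1 ≤ s ∧ s < t}) =>
      MeasurableSpace.comap (ξ s) inferInstance) s ⟨hs, hst⟩ le_rfl)

lemma past_mono {s t : ℕ} (hst : s ≤ t) : past ξ s ≤ past ξ t :=
  biSup_mono fun _ h => ⟨h.1, h.2.trans_le hst⟩

lemma past_le [m0 : MeasurableSpace Ω] (hξ : ∀ t, Measurable (ξ t)) (t : ℕ) : past ξ t ≤ m0 :=
  iSup₂_le fun s _ => (hξ s).comap_le

/-- The filtration whose member number `k` is generated by the samples `ξ 1, …, ξ (k + 1)`. -/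
def pastFiltration [m0 : MeasurableSpace Ω] (hξ : ∀ t, Measurable (ξ t)) : Filtration ℕ m0 where
  seq k := past ξ (k + 2)
  mono' _ _ h := past_mono (by omega)
  le' k := past_le hξ (k + 2)

variable [MeasurableSpace Ω] {μ : Measure Ω}

lemma BoundedNoise.ae_norm_noise_le
    (hN : BoundedNoise μ f g ξ (fun t ω => iterate g β βsq η lam xinit (fun s => ξ s ω) t) σ) :
    ∀ᵐ ω ∂μ, ∀ k, ‖noise f g β βsq η lam xinit (fun s => ξ s ω) k‖ ≤ σ :=
  ae_all_iff.2 fun k => hN.bounded (k + 1) (by omega)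

variable [IsProbabilityMeasure μ]

lemma BoundedNoise.integrable_noise
    (hN : BoundedNoise μ f g ξ (fun t ω => iterate g β βsq η lam xinit (fun s => ξ s ω) t) σ)
    (hg : Measurable fun p : Vec d × Ξ => g p.1 p.2) (hξ : ∀ t, Measurable (ξ t)) (k : ℕ) :
    Integrable (fun ω => noise f g β βsq η lam xinit (fun s => ξ s ω) k) μ :=
  Integrable.of_bound (measurable_noise hg k fun s _ _ => hξ s).aestronglyMeasurable σ
    (hN.ae_norm_noise_le.mono fun _ h => h k)

lemma BoundedNoise.condExp_noise
    (hN : BoundedNoise μ f g ξ (fun t ω => iterate g β βsq η lam xinit (fun s => ξ s ω) t) σ)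
    (hg : Measurable fun p : Vec d × Ξ => g p.1 p.2) (hξ : ∀ t, Measurable (ξ t)) (k : ℕ) :
    μ[fun ω => noise f g β βsq η lam xinit (fun s => ξ s ω) k | past ξ (k + 1)] =ᵐ[μ] 0 := by
  have hunb : μ[fun ω => sgrad g β βsq η lam xinit (fun s => ξ s ω) k | past ξ (k + 1)] =ᵐ[μ]
      fun ω => gradient f (run g β βsq η lam xinit (fun s => ξ s ω) k).x :=
    hN.unbiased (k + 1) (by omega)
  -- Integrability is not assumed. A conditional expectation is always integrable, hence so is the
  -- gradient, and the stochastic gradient is this plus bounded noise.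
  have hui : Integrable
      (fun ω => gradient f (run g β βsq η lam xinit (fun s => ξ s ω) k).x) μ :=
    integrable_condExp.congr hunb
  have hsi : Integrable (fun ω => sgrad g β βsq η lam xinit (fun s => ξ s ω) k) μ := by
    refine ((hN.integrable_noise hg hξ k).add hui).congr (ae_of_all _ fun ω => ?_)
    simp [noise]
  have hum : StronglyMeasurable[past ξ (k + 1)]
      (fun ω => gradient f (run g β βsq η lam xinit (fun s => ξ s ω) k).x) := by
    have hx := (@measurable_run d Ω Ξ _ g β βsq η lam xinit ξ (past ξ (k + 1)) hg k
      fun s h1 h2 => measurable_past h1 (by omega)).1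
    exact ((measurable_gradient f).comp hx).stronglyMeasurable
  have hsub := condExp_sub hsi hui (past ξ (k + 1))
  rw [condExp_of_stronglyMeasurable (past_le hξ _) hum hui] at hsub
  filter_upwards [hsub, hunb] with ω h1 h2
  refine (show _ = _ from h1).trans ?_
  simp [h2]

lemma stronglyMeasurable_crossTerm
    (hg : Measurable fun p : Vec d × Ξ => g p.1 p.2) (hξ : ∀ t, Measurable (ξ t)) (k : ℕ) :
    StronglyMeasurable[pastFiltration hξ (k + 1)]
      fun ω => crossTerm f g β βsq η lam xinit (fun s => ξ s ω) k := by
  have hmeas : ∀ s, 1 ≤ s → s ≤ k + 1 + 1 → Measurable[past ξ (k + 3)] (ξ s) :=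
    fun s h1 h2 => measurable_past h1 (by omega)
  have h1 := @measurable_average_noise d Ω Ξ _ f g β βsq η lam xinit ξ (past ξ (k + 3)) hg
    (weight β) k fun s h1 h2 => hmeas s h1 (by omega)
  have h2 := @measurable_noise d Ω Ξ _ f g β βsq η lam xinit ξ (past ξ (k + 3)) hg (k + 1) hmeas
  exact (h1.stronglyMeasurable.inner h2.stronglyMeasurable).const_mul _

/-- The averaged noise of index `k` uses `ξ 1, …, ξ (k + 1)`, which generate member `k` of the
filtration, so it is pulled out; the other factor uses `ξ (k + 2)` and has conditional mean zero. -/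
lemma BoundedNoise.condExp_crossTerm
    (hN : BoundedNoise μ f g ξ (fun t ω => iterate g β βsq η lam xinit (fun s => ξ s ω) t) σ)
    (hg : Measurable fun p : Vec d × Ξ => g p.1 p.2) (hξ : ∀ t, Measurable (ξ t))
    (hβ : 0 < β) (hβ1 : β ≤ 1) (k : ℕ) :
    μ[fun ω => crossTerm f g β βsq η lam xinit (fun s => ξ s ω) k | pastFiltration hξ k]
      =ᵐ[μ] 0 := by
  have h1 := (@measurable_average_noise d Ω Ξ _ f g β βsq η lam xinit ξ (past ξ (k + 2)) hg
    (weight β) k fun s h1 h2 => measurable_past h1 (by omega)).stronglyMeasurable.const_smul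
      (2 * weight β (k + 1) * (1 - weight β (k + 1)))
  have hcross : ∀ ω, crossTerm f g β βsq η lam xinit (fun s => ξ s ω) k =
      innerSL ℝ ((2 * weight β (k + 1) * (1 - weight β (k + 1))) •
        average (weight β) (noise f g β βsq η lam xinit fun s => ξ s ω) k)
        (noise f g β βsq η lam xinit (fun s => ξ s ω) (k + 1)) := by
    intro ω
    rw [innerSL_apply_apply, inner_smul_left, crossTerm]
    simp
  have hint : Integrable (fun ω => crossTerm f g β βsq η lam xinit (fun s => ξ s ω) k) μ :=
    Integrable.of_bound
      ((stronglyMeasurable_crossTerm hg hξ k).mono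
        ((pastFiltration hξ).le _)).aestronglyMeasurable (2 * weight β (k + 1) * σ ^ 2)
      (hN.ae_norm_noise_le.mono fun ω h => abs_crossTerm_le hβ hβ1 h k)
  have hpull := condExp_bilin_of_stronglyMeasurable_left (innerSL ℝ) h1
    (hint.congr (ae_of_all _ hcross)) (hN.integrable_noise hg hξ (k + 1))
  filter_upwards [hpull, hN.condExp_noise hg hξ (k + 1)] with ω h2 h3
  simp only [hcross]
  refine (show _ = _ from h2).trans ?_
  simp only [show k + 1 + 1 = k + 2 from rfl] at h3
  rw [h3]
  simp

/-- With high probability, the averaged noise is small in mean square. -/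
lemma BoundedNoise.measure_lt_sum_crossTerm_le
    (hN : BoundedNoise μ f g ξ (fun t ω => iterate g β βsq η lam xinit (fun s => ξ s ω) t) σ)
    (hg : Measurable fun p : Vec d × Ξ => g p.1 p.2) (hξ : ∀ t, Measurable (ξ t))
    (hβ : 0 < β) (hβ1 : β ≤ 1) {T : ℕ} (hT : 1 ≤ β ^ 2 * T) {ι : ℝ} (hι : 0 ≤ ι) :
    μ {ω | 6 * σ ^ 2 * (β ^ 2 * T) * Real.sqrt ι < ∑ k ∈ Finset.range T,
      crossTerm f g β βsq η lam xinit (fun s => ξ s ω) k} ≤ ENNReal.ofReal (Real.exp (-ι)) := by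
  -- Since `β ^ 2 * T ≥ 1`, the squared increments sum to at most `V`, and the threshold may be
  -- linear in `β ^ 2 * T` instead of its root; `6` is chosen because `6 ^ 2 ≥ 2 * 16`.
  refine measure_lt_sum_le (ℱ := pastFiltration hξ)
    (Y := fun k ω => crossTerm f g β βsq η lam xinit (fun s => ξ s ω) k)
    (c := fun k => 2 * weight β (k + 1) * σ ^ 2) (V := 16 * σ ^ 4 * (β ^ 2 * T))
    (stronglyMeasurable_crossTerm hg hξ)
    (fun k => hN.ae_norm_noise_le.mono fun ω h => abs_crossTerm_le hβ hβ1 h k)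
    (hN.condExp_crossTerm hg hξ hβ hβ1) ?_ (by positivity) ?_
  · calc ∑ k ∈ Finset.range T, (2 * weight β (k + 1) * σ ^ 2) ^ 2
        = 4 * σ ^ 4 * ∑ k ∈ Finset.range T, weight β (k + 1) ^ 2 := by
          rw [Finset.mul_sum]; exact Finset.sum_congr rfl fun k _ => by ring
      _ ≤ 4 * σ ^ 4 * (2 * β ^ 2 * T + 2) := by
          gcongr; exact sum_weight_sq_le hβ hβ1 T
      _ ≤ 4 * σ ^ 4 * (4 * (β ^ 2 * T)) := by gcongr; linarith
      _ = _ := by ring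
  · have h1 : Real.sqrt ι ^ 2 = ι := Real.sq_sqrt hι
    calc 2 * (16 * σ ^ 4 * (β ^ 2 * T)) * ι = 32 * (σ ^ 4 * ι * (β ^ 2 * T)) * 1 := by ring
      _ ≤ 36 * (σ ^ 4 * ι * (β ^ 2 * T)) * (β ^ 2 * T) := by
        have : 0 ≤ σ ^ 4 * ι * (β ^ 2 * T) := by positivity
        gcongr
        norm_num
      _ = 36 * σ ^ 4 * (β ^ 2 * T) ^ 2 * Real.sqrt ι ^ 2 := by rw [h1]; ring
      _ = _ := by ring

end noise

/-! ### The analysis of one run -/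

section path

variable {d : ℕ} {Ξ : Type*} {f : Vec d → ℝ} {D : Set (Vec d)} {g : Vec d → Ξ → Vec d}
  {L₀ Lρ ρ σ lam G β βsq η q : ℝ} {xinit : Vec d} {ξ : ℕ → Ξ}

/-- As long as the gradients are bounded by `G`, the objective decreases up to the noise, and the
gradients move slowly. -/
lemma descent_along_run (hf : IsL0LrhoSmoothOn f D L₀ Lρ ρ) (hD : IsOpen D) (hL₀ : 0 ≤ L₀)
    (hLρ : 0 ≤ Lρ) (hρ : 0 ≤ ρ) (hρ1 : ρ < 1) (hlam : 0 < lam) (hlamG : 2 * lam ≤ G)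
    (hσG : 2 * σ ≤ G) (hβ : 0 < β) (hβ1 : β ≤ 1) (hβsq : 0 ≤ βsq) (hβsq1 : βsq ≤ 1) (hη : 0 < η)
    (hnoise : ∀ k, ‖noise f g β βsq η lam xinit ξ k‖ ≤ σ)
    (hseg : ∀ k, segment ℝ (run g β βsq η lam xinit ξ k).x
      (run g β βsq η lam xinit ξ (k + 1)).x ⊆ D)
    (hr : ENNReal.ofReal (η / lam * (3 / 2 * G)) ≤ radius L₀ Lρ ρ G)
    (hLη : effSmooth L₀ Lρ ρ G * (η / lam) ≤ 1 / 8)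
    (hLq : effSmooth L₀ Lρ ρ G * (η / lam) ≤ q * β) (hq : 6 * q ^ 2 ≤ 1)
    (hqG : 192 * q ^ 2 * G ≤ lam) (K : ℕ)
    (hK : ∀ k < K, ‖gradient f (run g β βsq η lam xinit ξ k).x‖ ≤ G) :
    f (run g β βsq η lam xinit ξ K).x + η / (16 * G) *
        ∑ k ∈ Finset.range K, ‖gradient f (run g β βsq η lam xinit ξ k).x‖ ^ 2 ≤
      f xinit + 4 * (η / lam) * ∑ k ∈ Finset.range K,
        ‖average (weight β) (noise f g β βsq η lam xinit ξ) k‖ ^ 2 ∧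
    ∀ k < K, ‖gradient f (run g β βsq η lam xinit ξ (k + 1)).x -
        gradient f (run g β βsq η lam xinit ξ k).x‖ ≤
      effSmooth L₀ Lρ ρ G * (η / lam) * (3 / 2 * G) := by
  have hG : 0 < G := by linarith
  set L := effSmooth L₀ Lρ ρ G with hL
  have hL0 : 0 ≤ L := by rw [hL]; unfold effSmooth; positivity
  set X : ℕ → Vec d := fun k => (run g β βsq η lam xinit ξ k).x with hX
  set u : ℕ → Vec d := fun k => gradient f (X k) with hu
  set n : ℕ → Vec d := noise f g β βsq η lam xinit ξ with hn
  have hw := le_weight hβ hβ1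
  have hw1 := weight_le_one hβ hβ1
  have hsg : sgrad g β βsq η lam xinit ξ = fun j => u j + n j := by
    funext j; simp [hn, hu, hX, noise]
  have hbound : ∀ k < K, ‖sgrad g β βsq η lam xinit ξ k‖ ≤ 3 / 2 * G := by
    intro k hk
    rw [hsg]
    refine (norm_add_le _ _).trans ?_
    linarith [hK k hk, hnoise k]
  have hstep : ∀ k < K,
      ‖X (k + 1) - X k‖ ≤ η / lam * ‖average (weight β) (fun j => u j + n j) k‖ ∧
      inner ℝ (u k) (X (k + 1) - X k) + L * ‖X (k + 1) - X k‖ ^ 2 ≤ -(η / (8 * G)) * ‖u k‖ ^ 2 +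
        η / lam * ‖average (weight β) (fun j => u j + n j) k - u k‖ ^ 2 := by
    intro k hk
    choose h h1 h2 h3 using run_x_succ (g := g) (xinit := xinit) (ξ := ξ) hβ hβ1 hβsq hβsq1 hη hlam
      (by positivity : 0 ≤ 3 / 2 * G) k (fun j hj => hbound j (hj.trans_lt hk))
    -- `3 / 2 * G + lam ≤ 2 * G`, as `2 * lam ≤ G`.
    have hlo : ∀ i, η / (2 * G) ≤ h i := fun i => by
      refine le_trans ?_ (h1 i)
      gcongr
      linarith
    rw [hsg] at h3
    have := preconditioned_step (u := u k) hL0 hlo (by positivity) h2 hLη h3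
    rwa [show η / (2 * G) / 4 = η / (8 * G) by field_simp; norm_num] at this
  have havg : ∀ k < K, ‖average (weight β) (fun j => u j + n j) k‖ ≤ 3 / 2 * G := by
    intro k hk
    refine norm_average_le (fun k => hβ.le.trans (hw k)) hw1 k fun j hj => ?_
    have := hbound j (hj.trans_lt hk)
    rwa [hsg] at this
  have hlen : ∀ k < K, ‖X (k + 1) - X k‖ ≤ η / lam * (3 / 2 * G) := fun k hk =>
    (hstep k hk).1.trans (mul_le_mul_of_nonneg_left (havg k hk) (by positivity))
  have hgrad : ∀ k < K, ‖u (k + 1) - u k‖ ≤ L * ‖X (k + 1) - X k‖ := fun k hk =>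
    hf.norm_gradient_sub_le hD hL₀ hLρ hρ hρ1 hG (hseg k) (hK k hk)
      ((ENNReal.ofReal_le_ofReal (hlen k hk)).trans hr)
  refine ⟨?_, fun k hk => (hgrad k hk).trans ?_⟩
  · have := descent_sum (F := fun k => f (X k)) (u := u) (n := n) (α := weight β)
      (p := L * (η / lam)) (q := q) (a := η / (8 * G)) (A := η / lam) hβ hw hw1 (by positivity)
      hLq (by positivity) hq ?_ K ?_ ?_
    · rwa [show η / (8 * G) / 2 = η / (16 * G) by field_simp; norm_num] at this
    -- With `a = η / (8 * G)` and `A = η / lam`, the condition `24 * q ^ 2 * A ≤ a` reads `192 * q ^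
    -- 2 * G ≤ lam`.
    · rw [mul_div_assoc', div_le_div_iff₀ hlam (by positivity)]
      nlinarith
    · intro k hk
      refine (hgrad k hk).trans ?_
      rw [mul_assoc]
      exact mul_le_mul_of_nonneg_left (hstep k hk).1 hL0
    · intro k hk
      have h1 := hf.le_add_inner_add hD hL₀ hLρ hρ hρ1 hG (hseg k) (hK k hk)
        ((ENNReal.ofReal_le_ofReal (hlen k hk)).trans hr)
      have h2 := (hstep k hk).2
      simp only [hX, hu] at h1 h2 ⊢
      linarith
  · rw [mul_assoc]
    exact mul_le_mul_of_nonneg_left (hlen k hk) hL0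

/-- If the accumulated noise is small, all gradients up to time `T` are bounded by `G`, and their
mean square is controlled. -/
lemma gradients_along_run (hf : IsL0LrhoSmoothOn f D L₀ Lρ ρ) (hD : IsOpen D)
    (hinit : xinit ∈ D) (hbdd : BddBelow (f '' D)) (hL₀ : 0 ≤ L₀)
    (hLρ : 0 ≤ Lρ) (hρ : 0 ≤ ρ) (hρ1 : ρ < 1) (hlam : 0 < lam) (hlamG : 2 * lam ≤ G)
    (hσG : 2 * σ ≤ G) (hβ : 0 < β) (hβ1 : β ≤ 1) (hβsq : 0 ≤ βsq) (hβsq1 : βsq ≤ 1) (hη : 0 < η)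
    (hnoise : ∀ k, ‖noise f g β βsq η lam xinit ξ k‖ ≤ σ)
    (hseg : ∀ k, segment ℝ (run g β βsq η lam xinit ξ k).x
      (run g β βsq η lam xinit ξ (k + 1)).x ⊆ D)
    (hr : ENNReal.ofReal (η / lam * (3 / 2 * G)) ≤ radius L₀ Lρ ρ G)
    (hLη : effSmooth L₀ Lρ ρ G * (η / lam) ≤ 1 / 8)
    (hLq : effSmooth L₀ Lρ ρ G * (η / lam) ≤ q * β) (hq : 6 * q ^ 2 ≤ 1)
    (hqG : 192 * q ^ 2 * G ≤ lam) (hgrad : 2 * ‖gradient f xinit‖ ≤ G) {T : ℕ} {S : ℝ}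
    (hS : ∑ k ∈ Finset.range T, ‖average (weight β) (noise f g β βsq η lam xinit ξ) k‖ ^ 2 ≤ S)
    (hSG : 768 * (effSmooth L₀ Lρ ρ G / lam) * (gap f D xinit + 4 * (η / lam) * S) ≤ G) :
    (∀ k < T, ‖gradient f (run g β βsq η lam xinit ξ k).x‖ ≤ G) ∧
      η / (16 * G) * ∑ k ∈ Finset.range T, ‖gradient f (run g β βsq η lam xinit ξ k).x‖ ^ 2 ≤
        gap f D xinit + 4 * (η / lam) * S := by
  have hG : 0 < G := by linarith
  have hL0 : 0 ≤ effSmooth L₀ Lρ ρ G := by unfold effSmooth; positivity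
  have hsum : ∀ K ≤ T, (∀ k < K, ‖gradient f (run g β βsq η lam xinit ξ k).x‖ ≤ G) →
      η / (16 * G) * ∑ k ∈ Finset.range K, ‖gradient f (run g β βsq η lam xinit ξ k).x‖ ^ 2 ≤
        gap f D xinit + 4 * (η / lam) * S := by
    intro K hKT hK
    have h := (descent_along_run hf hD hL₀ hLρ hρ hρ1 hlam hlamG hσG hβ hβ1 hβsq hβsq1 hη hnoise
      hseg hr hLη hLq hq hqG K hK).1
    have hmem : (run g β βsq η lam xinit ξ K).x ∈ D := by
      cases K with
      | zero => exact hinit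
      | succ K => exact hseg K (right_mem_segment ℝ _ _)
    have hinf : sInf (f '' D) ≤ f (run g β βsq η lam xinit ξ K).x :=
      csInf_le hbdd (mem_image_of_mem f hmem)
    have hSK : ∑ k ∈ Finset.range K,
        ‖average (weight β) (noise f g β βsq η lam xinit ξ) k‖ ^ 2 ≤ S :=
      (Finset.sum_le_sum_of_subset_of_nonneg (Finset.range_mono hKT)
        fun _ _ _ => sq_nonneg _).trans hS
    have h2 : 4 * (η / lam) * ∑ k ∈ Finset.range K,
        ‖average (weight β) (noise f g β βsq η lam xinit ξ) k‖ ^ 2 ≤ 4 * (η / lam) * S := by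
      gcongr
    unfold gap
    linarith
  have hall : ∀ K < T, ‖gradient f (run g β βsq η lam xinit ξ K).x‖ ≤ G := by
    intro K
    induction K using Nat.strong_induction_on with
    | _ K ih =>
      intro hKT
      have hK : ∀ k < K, ‖gradient f (run g β βsq η lam xinit ξ k).x‖ ≤ G :=
        fun k hk => ih k hk (hk.trans hKT)
      have hmove := (descent_along_run hf hD hL₀ hLρ hρ hρ1 hlam hlamG hσG hβ hβ1 hβsq hβsq1 hη
        hnoise hseg hr hLη hLq hq hqG K hK).2
      have hU := hsum K hKT.le hK
      have h1 := norm_le_half_add_sum (u := fun k => gradient f (run g β βsq η lam xinit ξ k).x) hG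
        (ℓ := effSmooth L₀ Lρ ρ G * (η / lam) * (3 / 2 * G)) (by positivity) (by nlinarith)
        (by simp only [run]; linarith) K hmove
      refine h1.trans ?_
      set U := ∑ k ∈ Finset.range K, ‖gradient f (run g β βsq η lam xinit ξ k).x‖ ^ 2
      -- `384 = 16 * (3 / 2) * 16`; the constant `768` in `hSG` makes this half at most `G / 2`.
      have h2 : 16 * (effSmooth L₀ Lρ ρ G * (η / lam) * (3 / 2 * G)) / G ^ 2 * U =
          384 * (effSmooth L₀ Lρ ρ G / lam) * (η / (16 * G) * U) := by
        field_simp; ring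
      have h3 : 384 * (effSmooth L₀ Lρ ρ G / lam) * (η / (16 * G) * U) ≤
          384 * (effSmooth L₀ Lρ ρ G / lam) * (gap f D xinit + 4 * (η / lam) * S) := by
        gcongr
      rw [h2]
      linarith
  exact ⟨hall, hsum T le_rfl hall⟩

end path

/-! ### The parameters -/

section parameters

variable {c₁ c₂ δ ε σ lam L₀ Lρ ρ G β η C₂ Δ₁ : ℝ}

lemma effSmooth_nonneg (hL₀ : 0 ≤ L₀) (hLρ : 0 ≤ Lρ) (hG : 0 ≤ G) : 0 ≤ effSmooth L₀ Lρ ρ G := by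
  unfold effSmooth; positivity

lemma Admissible.β_le_one (h : Admissible c₁ c₂ δ ε σ lam L₀ Lρ ρ G β η) : β ≤ 1 :=
  ENNReal.ofReal_le_one.1 (h.β_le.trans (min_le_left _ _))

/-- Cleared of its denominator, the condition stays meaningful for `σ = 0`. -/
lemma Admissible.β_mul_le (h : Admissible c₁ c₂ δ ε σ lam L₀ Lρ ρ G β η) (hc₁ : 0 ≤ c₁)
    (hlam : 0 ≤ lam) :
    β * (σ ^ 2 * G * Real.sqrt (Real.log (1 / δ))) ≤ c₁ * lam * ε ^ 2 := by
  have h1 := ENNReal.mul_le_of_le_div (h.β_le.trans (min_le_right _ _))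
  rw [← ENNReal.ofReal_mul h.β_pos.le] at h1
  exact (ENNReal.ofReal_le_ofReal_iff (by positivity)).1 h1

lemma Admissible.η_mul_le (h : Admissible c₁ c₂ δ ε σ lam L₀ Lρ ρ G β η) (hc₂ : 0 ≤ c₂) :
    η * (G * effSmooth L₀ Lρ ρ G * Real.sqrt (Real.log (1 / δ))) ≤ c₂ * (lam ^ 2 * β) := by
  have h1 := h.η_le.trans (mul_le_mul_right (min_le_right _ _) _)
  rw [← mul_div_assoc, ← ENNReal.ofReal_mul hc₂] at h1
  have h2 := ENNReal.mul_le_of_le_div h1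
  rw [← ENNReal.ofReal_mul h.η_pos.le] at h2
  have := h.β_pos.le
  exact (ENNReal.ofReal_le_ofReal_iff (by positivity)).1 h2

lemma Admissible.step_le_radius (h : Admissible c₁ c₂ δ ε σ lam L₀ Lρ ρ G β η) (hc₂ : 0 ≤ c₂)
    (hc₂' : c₂ ≤ 1 / 2) (hlam : 0 < lam) (hG : 0 < G) :
    ENNReal.ofReal (η / lam * (3 / 2 * G)) ≤ radius L₀ Lρ ρ G := by
  have h1 := h.η_le.trans (mul_le_mul_right (min_le_left _ _) _)
  have hη := h.η_pos
  calc ENNReal.ofReal (η / lam * (3 / 2 * G))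
      = ENNReal.ofReal η * ENNReal.ofReal (3 / 2 * G / lam) := by
        rw [← ENNReal.ofReal_mul hη.le]; congr 1; ring
    _ ≤ ENNReal.ofReal c₂ * (radius L₀ Lρ ρ G * ENNReal.ofReal lam / ENNReal.ofReal G) *
        ENNReal.ofReal (3 / 2 * G / lam) := by gcongr
    _ = radius L₀ Lρ ρ G * (ENNReal.ofReal c₂ * ENNReal.ofReal lam * ENNReal.ofReal G⁻¹ *
        ENNReal.ofReal (3 / 2 * G / lam)) := by
        rw [div_eq_mul_inv, ENNReal.ofReal_inv_of_pos hG]; ring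
    _ = radius L₀ Lρ ρ G * ENNReal.ofReal (3 / 2 * c₂) := by
        rw [← ENNReal.ofReal_mul hc₂, ← ENNReal.ofReal_mul (by positivity),
          ← ENNReal.ofReal_mul (by positivity)]
        congr 2; field_simp
    _ ≤ radius L₀ Lρ ρ G * 1 := by
        gcongr
        exact ENNReal.ofReal_le_one.2 (by linarith)
    _ = _ := mul_one _

lemma le_horizon (C₂ Δ₁ G ε β η : ℝ) :
    max (1 / β ^ 2) (C₂ * Δ₁ * G / (η * ε ^ 2)) ≤ horizon C₂ Δ₁ G ε β η := Nat.le_ceil _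

lemma horizon_le (hβ : 0 < β) (hβ1 : β ≤ 1) (hnn : 0 ≤ C₂ * Δ₁ * G / (η * ε ^ 2)) :
    (horizon C₂ Δ₁ G ε β η : ℝ) ≤ 2 * (1 / β ^ 2) + 2 * (C₂ * Δ₁ * G / (η * ε ^ 2)) := by
  have h1 : 1 ≤ 1 / β ^ 2 := by
    rw [le_div_iff₀ (by positivity), one_mul]; exact pow_le_one₀ hβ.le hβ1
  have h2 := (Nat.ceil_lt_add_one
    ((by positivity : 0 ≤ 1 / β ^ 2).trans (le_max_left _ (C₂ * Δ₁ * G / (η * ε ^ 2))))).le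
  have h3 : max (1 / β ^ 2) (C₂ * Δ₁ * G / (η * ε ^ 2)) ≤
      1 / β ^ 2 + C₂ * Δ₁ * G / (η * ε ^ 2) :=
    max_le (by linarith) (by linarith)
  unfold horizon
  linarith

lemma exists_pos_ofReal_le {a : ℝ≥0∞} (ha : a ≠ 0) : ∃ r : ℝ, 0 < r ∧ ENNReal.ofReal r ≤ a := by
  rcases eq_or_ne a ⊤ with rfl | h
  · exact ⟨1, one_pos, le_top⟩
  · exact ⟨a.toReal, ENNReal.toReal_pos ha h, (ENNReal.ofReal_toReal h).le⟩

lemma radius_ne_zero (hG : 0 < G) (hL₀ : 0 ≤ L₀) (hρ : 0 ≤ ρ) : radius L₀ Lρ ρ G ≠ 0 := by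
  have h1 : 5 * ENNReal.ofReal Lρ * ENNReal.ofReal G ^ (ρ - 1) ≠ ⊤ := by
    rw [ENNReal.ofReal_rpow_of_pos hG]
    exact ENNReal.mul_ne_top (ENNReal.mul_ne_top (by simp) ENNReal.ofReal_ne_top)
      ENNReal.ofReal_ne_top
  have h2 : (if ρ = 0 ∨ L₀ = 0 then ⊤
      else 1 / (5 * (ENNReal.ofReal L₀ ^ (ρ - 1) * ENNReal.ofReal Lρ) ^ (1 / ρ))) ≠ 0 := by
    split_ifs with h
    · simp
    · rw [not_or] at h
      have hpos : 0 < L₀ := lt_of_le_of_ne hL₀ (Ne.symm h.2)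
      rw [ENNReal.ofReal_rpow_of_pos hpos]
      refine (ENNReal.div_pos one_ne_zero (ENNReal.mul_ne_top (by simp) ?_)).ne'
      exact ENNReal.rpow_ne_top_of_nonneg (by positivity)
        (ENNReal.mul_ne_top ENNReal.ofReal_ne_top ENNReal.ofReal_ne_top)
  unfold radius
  exact (lt_min (ENNReal.div_pos one_ne_zero h1) (pos_iff_ne_zero.2 h2)).ne'

/-- Admissible parameters for which the number of iterations is of order `ε⁻⁴`. -/
lemma exists_admissible (hc₁ : 0 < c₁) (hc₂ : 0 < c₂) (hC₂ : 0 < C₂) (hL₀ : 0 ≤ L₀) (hρ : 0 ≤ ρ)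
    (hlam : 0 < lam) (hG : 0 < G) (hΔ₁ : 0 ≤ Δ₁) :
    ∃ K : ℝ, 0 < K ∧ ∀ ε : ℝ, 0 < ε → ε ≤ 1 →
      ∃ β η : ℝ, Admissible c₁ c₂ δ ε σ lam L₀ Lρ ρ G β η ∧
        (horizon C₂ Δ₁ G ε β η : ℝ) ≤ K / ε ^ 4 := by
  set w := Real.sqrt (Real.log (1 / δ)) with hw
  obtain ⟨b, hb, hbβ⟩ : ∃ b : ℝ, 0 < b ∧ ENNReal.ofReal b ≤
      min 1 (ENNReal.ofReal (c₁ * lam) / ENNReal.ofReal (σ ^ 2 * G * w)) :=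
    exists_pos_ofReal_le (lt_min one_pos (ENNReal.div_pos
      (ENNReal.ofReal_pos.2 (by positivity)).ne' ENNReal.ofReal_ne_top)).ne'
  obtain ⟨e, he, heη⟩ : ∃ e : ℝ, 0 < e ∧ ENNReal.ofReal e ≤ ENNReal.ofReal c₂ *
      min (radius L₀ Lρ ρ G * ENNReal.ofReal lam / ENNReal.ofReal G)
        (ENNReal.ofReal (lam ^ 2) / ENNReal.ofReal (G * effSmooth L₀ Lρ ρ G * w)) :=
    exists_pos_ofReal_le (mul_ne_zero (ENNReal.ofReal_pos.2 hc₂).ne' (lt_min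
      (ENNReal.div_pos (mul_ne_zero (radius_ne_zero hG hL₀ hρ) (ENNReal.ofReal_pos.2 hlam).ne')
        ENNReal.ofReal_ne_top)
      (ENNReal.div_pos (ENNReal.ofReal_pos.2 (by positivity)).ne' ENNReal.ofReal_ne_top)).ne')
  refine ⟨1 / b ^ 2 + C₂ * Δ₁ * G / (e * b) + 1, by positivity, fun ε hε hε1 => ?_⟩
  have hε2 : ε ^ 2 ≤ 1 := pow_le_one₀ hε.le hε1
  have hb1 : b ≤ 1 := ENNReal.ofReal_le_one.1 (hbβ.trans (min_le_left _ _))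
  have hβ1 : b * ε ^ 2 ≤ 1 := mul_le_one₀ hb1 (by positivity) hε2
  -- `b` and `e` are bounds free of `ε`. With `β = b * ε ^ 2` and `η = e * β`, both `1 / β ^ 2` and
  -- `1 / (η * ε ^ 2)` are multiples of `ε⁻⁴`; `β ≤ 1` keeps `η` within the radius term.
  refine ⟨b * ε ^ 2, e * (b * ε ^ 2), ⟨by positivity, by positivity, le_min ?_ ?_, ?_⟩, ?_⟩
  · exact ENNReal.ofReal_le_one.2 hβ1
  · calc ENNReal.ofReal (b * ε ^ 2) = ENNReal.ofReal b * ENNReal.ofReal (ε ^ 2) :=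
          ENNReal.ofReal_mul hb.le
      _ ≤ ENNReal.ofReal (c₁ * lam) / ENNReal.ofReal (σ ^ 2 * G * w) * ENNReal.ofReal (ε ^ 2) := by
          gcongr; exact hbβ.trans (min_le_right _ _)
      _ = _ := by
          rw [ENNReal.ofReal_mul (p := c₁ * lam) (by positivity), ENNReal.mul_div_right_comm]
  · rw [ENNReal.ofReal_mul he.le]
    calc ENNReal.ofReal e * ENNReal.ofReal (b * ε ^ 2)
        ≤ ENNReal.ofReal c₂ * min (radius L₀ Lρ ρ G * ENNReal.ofReal lam / ENNReal.ofReal G)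
          (ENNReal.ofReal (lam ^ 2) / ENNReal.ofReal (G * effSmooth L₀ Lρ ρ G * w)) *
            ENNReal.ofReal (b * ε ^ 2) := by gcongr
      _ ≤ _ := by
          rw [mul_assoc]
          gcongr
          refine le_min ?_ ?_
          · calc _ ≤ (radius L₀ Lρ ρ G * ENNReal.ofReal lam / ENNReal.ofReal G) * 1 := by
                  gcongr
                  · exact min_le_left _ _
                  · exact ENNReal.ofReal_le_one.2 hβ1
              _ = _ := mul_one _
          · calc _ ≤ ENNReal.ofReal (lam ^ 2) / ENNReal.ofReal (G * effSmooth L₀ Lρ ρ G * w) *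
                  ENNReal.ofReal (b * ε ^ 2) := by
                  gcongr
                  exact min_le_right _ _
              _ = _ := by
                  rw [ENNReal.ofReal_mul (p := lam ^ 2) (by positivity),
                    ENNReal.mul_div_right_comm]
  · have h1 := (Nat.ceil_lt_add_one ((by positivity : 0 ≤ 1 / (b * ε ^ 2) ^ 2).trans
      (le_max_left _ (C₂ * Δ₁ * G / (e * (b * ε ^ 2) * ε ^ 2))))).le
    have h2 : max (1 / (b * ε ^ 2) ^ 2) (C₂ * Δ₁ * G / (e * (b * ε ^ 2) * ε ^ 2)) ≤
        1 / (b * ε ^ 2) ^ 2 + C₂ * Δ₁ * G / (e * (b * ε ^ 2) * ε ^ 2) :=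
      max_le (le_add_of_nonneg_right (by positivity)) (le_add_of_nonneg_left (by positivity))
    have h3 : 1 ≤ 1 / ε ^ 4 := by
      rw [le_div_iff₀ (by positivity), one_mul]; exact pow_le_one₀ hε.le hε1
    have h4 : (1 / b ^ 2 + C₂ * Δ₁ * G / (e * b) + 1) / ε ^ 4 =
        1 / (b * ε ^ 2) ^ 2 + C₂ * Δ₁ * G / (e * (b * ε ^ 2) * ε ^ 2) + 1 / ε ^ 4 := by
      field_simp
    unfold horizon
    rw [h4]
    linarith

end parameters

/-! ### Convergence -/

section convergence

variable {d : ℕ} {Ω Ξ : Type*} {f : Vec d → ℝ} {D : Set (Vec d)} {g : Vec d → Ξ → Vec d}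
  {xinit : Vec d} {L₀ Lρ ρ σ lam δ ε G β βsq η C C₁ C₂ c₁ c₂ w₀ : ℝ}

lemma gap_nonneg (hinit : xinit ∈ D) (hbdd : BddBelow (f '' D)) : 0 ≤ gap f D xinit :=
  sub_nonneg.2 (csInf_le hbdd (mem_image_of_mem f hinit))

/-- The exponent `1 / (1 - ρ)` is made for this: `C₁ Δ Lρ ≤ lam * G ^ (1 - ρ)`, times `G ^ ρ`, is
linear in `G`. The factor is `7 = 3 + 4`. -/
lemma effSmooth_mul_gap_le {Δ : ℝ} (hlam : 0 < lam) (hG : 0 < G) (hC₁ : 0 < C₁) (hΔ : 0 ≤ Δ)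
    (hLρ : 0 ≤ Lρ) (hρ1 : ρ < 1) (h₀ : C₁ * Δ * L₀ / lam ≤ G)
    (h₁ : (C₁ * Δ * Lρ / lam) ^ (1 / (1 - ρ)) ≤ G) :
    C₁ * (effSmooth L₀ Lρ ρ G * Δ) ≤ 7 * (lam * G) := by
  have hρ' : 0 < 1 - ρ := by linarith
  have h2 : C₁ * Δ * Lρ / lam ≤ G ^ (1 - ρ) := by
    have := Real.rpow_le_rpow (by positivity) h₁ hρ'.le
    rwa [← Real.rpow_mul (by positivity), one_div_mul_cancel hρ'.ne', Real.rpow_one] at this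
  rw [div_le_iff₀ hlam] at h₀ h2
  have h3 : G ^ (1 - ρ) * G ^ ρ = G := by
    rw [← Real.rpow_add hG]; simp
  have h4 : C₁ * Δ * Lρ * G ^ ρ ≤ G * lam := by
    calc C₁ * Δ * Lρ * G ^ ρ ≤ G ^ (1 - ρ) * lam * G ^ ρ := by gcongr
      _ = G ^ (1 - ρ) * G ^ ρ * lam := by ring
      _ = G * lam := by rw [h3]
  unfold effSmooth
  linarith

/-- The bound on the accumulated noise, given the bound on the cross terms. -/
lemma sum_averaged_noise_le {ξ : ℕ → Ξ} {w : ℝ} {T : ℕ} (hβ : 0 < β) (hβ1 : β ≤ 1)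
    (hw₀ : 0 < w₀) (hw : w₀ ≤ w) (hT : 1 ≤ β ^ 2 * T)
    (hnoise : ∀ k, ‖noise f g β βsq η lam xinit ξ k‖ ≤ σ)
    (hcross : ∑ k ∈ Finset.range T, crossTerm f g β βsq η lam xinit ξ k ≤
      6 * σ ^ 2 * (β ^ 2 * T) * w) :
    ∑ k ∈ Finset.range T, ‖average (weight β) (noise f g β βsq η lam xinit ξ) k‖ ^ 2 ≤
      (6 + 5 / w₀) * w * (σ ^ 2 * β * T) := by
  have h1 := sum_norm_average_sq_le hβ (le_weight hβ hβ1) (weight_le_one hβ hβ1) hnoise T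
  have h2 : σ ^ 2 * ∑ k ∈ Finset.range T, weight β (k + 1) ^ 2 ≤ σ ^ 2 * (2 * β ^ 2 * T + 2) := by
    gcongr; exact sum_weight_sq_le hβ hβ1 T
  have h3 : σ ^ 2 * 1 ≤ σ ^ 2 * (β ^ 2 * T) := by gcongr
  -- The deterministic terms add up to at most `5 * σ ^ 2 * (β ^ 2 * T)` and lack the factor `w`; `w
  -- ≥ w₀` supplies it, and thus the constants depend on `δ₀`.
  have h4 : 5 ≤ 5 / w₀ * w := by
    rw [div_mul_eq_mul_div, le_div_iff₀ hw₀]; linarith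
  have h5 : 5 * (σ ^ 2 * (β ^ 2 * T)) ≤ 5 / w₀ * w * (σ ^ 2 * (β ^ 2 * T)) := by gcongr
  have h6 : 0 ≤ ‖average (weight β) (noise f g β βsq η lam xinit ξ) T‖ ^ 2 := sq_nonneg _
  refine le_of_mul_le_mul_left ?_ hβ
  have h7 : β * ((6 + 5 / w₀) * w * (σ ^ 2 * β * T)) =
      6 * σ ^ 2 * (β ^ 2 * T) * w + 5 / w₀ * w * (σ ^ 2 * (β ^ 2 * T)) := by ring
  rw [h7]
  unfold crossTerm at hcross
  linarith

/-- The accumulated noise is within the budget that keeps the gradients below `G`. -/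
lemma noise_budget {L Δ w T : ℝ} (hlam : 0 < lam) (hG : 0 < G) (hβ : 0 < β) (hη : 0 < η)
    (hε : 0 < ε) (hL : 0 ≤ L) (hΔ : 0 ≤ Δ) (hw : 0 < w) (hC : 0 < C) (hC₁ : 20000 ≤ C₁)
    (hC₂ : 0 < C₂) (hσ : 0 ≤ σ) (hσG : 2 * σ ≤ G)
    (hc₁ : 8 * C * C₂ * c₁ ≤ 1) (hc₂ : 5000 * C * c₂ ≤ 1)
    (hLΔ : C₁ * (L * Δ) ≤ 7 * (lam * G)) (hβle : β * (σ ^ 2 * G * w) ≤ c₁ * lam * ε ^ 2)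
    (hηle : η * (G * L * w) ≤ c₂ * (lam ^ 2 * β))
    (hT : T ≤ 2 * (1 / β ^ 2) + 2 * (C₂ * Δ * G / (η * ε ^ 2))) :
    768 * (L / lam) * (Δ + 4 * (η / lam) * (C * w * (σ ^ 2 * β * T))) ≤ G := by
  have hLΔ' : L * Δ / lam ≤ 7 / 20000 * G := by
    rw [div_le_iff₀ hlam]
    have : 20000 * (L * Δ) ≤ C₁ * (L * Δ) := by gcongr
    linarith
  have hsplit : 768 * (L / lam) * (Δ + 4 * (η / lam) * (C * w * (σ ^ 2 * β * T))) ≤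
      768 * (L / lam) * (Δ + 4 * (η / lam) * (C * w * (σ ^ 2 * β *
        (2 * (1 / β ^ 2) + 2 * (C₂ * Δ * G / (η * ε ^ 2)))))) := by gcongr
  -- The three terms come from the initial gap, from `1 / β ^ 2` in `T` (controlled by the condition
  -- on `η`) and from the gap term in `T` (controlled by the condition on `β`). Together they stay
  -- below `G`.
  have hrest : 768 * (L / lam) * (Δ + 4 * (η / lam) * (C * w * (σ ^ 2 * β *
        (2 * (1 / β ^ 2) + 2 * (C₂ * Δ * G / (η * ε ^ 2)))))) =
      768 * (L * Δ / lam) + 768 * (8 * C * σ ^ 2 / (G * lam ^ 2 * β) * (η * (G * L * w))) +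
        768 * (8 * C * C₂ / (lam * ε ^ 2) * (L * Δ / lam) * (β * (σ ^ 2 * G * w))) := by
    field_simp
    ring
  have h1 : 8 * C * σ ^ 2 / (G * lam ^ 2 * β) * (η * (G * L * w)) ≤ 2 / 5000 * G := by
    calc 8 * C * σ ^ 2 / (G * lam ^ 2 * β) * (η * (G * L * w))
        ≤ 8 * C * σ ^ 2 / (G * lam ^ 2 * β) * (c₂ * (lam ^ 2 * β)) := by gcongr
      _ = C * c₂ * (2 * (2 * σ) ^ 2) / G := by field_simp; ring
      _ ≤ 1 / 5000 * (2 * G ^ 2) / G := by gcongr; linarith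
      _ = 2 / 5000 * G := by field_simp
  have h2 : 8 * C * C₂ / (lam * ε ^ 2) * (L * Δ / lam) * (β * (σ ^ 2 * G * w)) ≤ L * Δ / lam := by
    calc _ ≤ 8 * C * C₂ / (lam * ε ^ 2) * (L * Δ / lam) * (c₁ * lam * ε ^ 2) := by gcongr
      _ = 8 * C * C₂ * c₁ * (L * Δ / lam) := by field_simp
      _ ≤ 1 * (L * Δ / lam) := by gcongr
      _ = _ := one_mul _
  rw [hrest] at hsplit
  linarith

/-- From the accumulated descent to the mean square of the gradients. -/
lemma mean_sq_le {Δ w U : ℝ} {T : ℕ} (hlam : 0 < lam) (hG : 0 < G) (hη : 0 < η)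
    (hε : 0 < ε) (hC : 0 < C) (hC₂ : 20000 ≤ C₂) (hΔ : 0 ≤ Δ) (hc₁ : 5000 * C * c₁ ≤ 1)
    (hT0 : (0 : ℝ) < T) (hβle : β * (σ ^ 2 * G * w) ≤ c₁ * lam * ε ^ 2)
    (hT : C₂ * Δ * G / (η * ε ^ 2) ≤ T)
    (hU : η / (16 * G) * U ≤ Δ + 4 * (η / lam) * (C * w * (σ ^ 2 * β * T))) :
    1 / (T : ℝ) * U ≤ ε ^ 2 := by
  rw [one_div, inv_mul_le_iff₀ hT0]
  have h1 : 20000 * (16 * G * Δ / η) ≤ 16 * (T * ε ^ 2) := by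
    rw [div_le_iff₀ (by positivity)] at hT
    rw [mul_div_assoc', div_le_iff₀ hη]
    have : 20000 * (Δ * G) ≤ C₂ * (Δ * G) := by gcongr
    linarith
  have h2 : U ≤ 16 * G * Δ / η + 64 * C * T / lam * (β * (σ ^ 2 * G * w)) := by
    have h3 : 16 * G * Δ / η + 64 * C * T / lam * (β * (σ ^ 2 * G * w)) =
        16 * G / η * (Δ + 4 * (η / lam) * (C * w * (σ ^ 2 * β * T))) := by
      field_simp; ring
    rw [h3]
    calc U = 16 * G / η * (η / (16 * G) * U) := by field_simp
      _ ≤ _ := by gcongr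
  have h4 : 64 * C * T / lam * (β * (σ ^ 2 * G * w)) ≤ 64 / 5000 * (T * ε ^ 2) := by
    calc _ ≤ 64 * C * T / lam * (c₁ * lam * ε ^ 2) := by gcongr
      _ = 64 * (C * c₁) * (T * ε ^ 2) := by field_simp
      _ ≤ 64 * (1 / 5000) * (T * ε ^ 2) := by gcongr; linarith
      _ = _ := by ring
  have h5 : 0 ≤ T * ε ^ 2 := by positivity
  linarith

lemma sum_Icc_iterate (g : Vec d → Ξ → Vec d) (ξ : ℕ → Ξ) (h : Vec d → ℝ) (T : ℕ) :
    ∑ t ∈ Finset.Icc 1 T, h (iterate g β βsq η lam xinit ξ t) =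
      ∑ k ∈ Finset.range T, h (run g β βsq η lam xinit ξ k).x := by
  refine Finset.sum_nbij' (fun t => t - 1) (fun k => k + 1) ?_ ?_ ?_ ?_ ?_
  · intro t ht; simp only [Finset.mem_Icc, Finset.mem_range] at ht ⊢; omega
  · intro k hk; simp only [Finset.mem_Icc, Finset.mem_range] at hk ⊢; omega
  · intro t ht; simp only [Finset.mem_Icc] at ht; omega
  · intro k _; simp
  · intro t _; rfl

variable [MeasurableSpace Ω] [MeasurableSpace Ξ] {μ : Measure Ω} [IsProbabilityMeasure μ]
  {ξ : ℕ → Ω → Ξ}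

/-- Bounded gradients and convergence of Adam, with explicit constants. -/
lemma convergence (hw₀ : 0 < w₀) (hC : C = 6 + 5 / w₀) (hC₁ : 20000 ≤ C₁) (hC₂ : 20000 ≤ C₂)
    (hc₁0 : 0 < c₁) (hc₁ : 8 * C * C₂ * c₁ ≤ 1) (hc₁' : 5000 * C * c₁ ≤ 1)
    (hc₂0 : 0 < c₂) (hc₂ : 5000 * C * c₂ ≤ 1) (hc₂half : c₂ ≤ 1 / 2) (hc₂w : 10 * c₂ ≤ w₀)
    (hL₀ : 0 ≤ L₀) (hLρ : 0 ≤ Lρ) (hρ : 0 ≤ ρ) (hρ1 : ρ < 1) (hσ : 0 ≤ σ) (hlam : 0 < lam)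
    (hδ : 0 < δ) (hδw : w₀ ≤ Real.sqrt (Real.log (1 / δ))) (hε : 0 < ε)
    (hD : IsOpen D) (hinit : xinit ∈ D) (hbdd : BddBelow (f '' D))
    (hf : IsL0LrhoSmoothOn f D L₀ Lρ ρ) (hg : Measurable fun p : Vec d × Ξ => g p.1 p.2)
    (hξ : ∀ t, Measurable (ξ t))
    (hN : BoundedNoise μ f g ξ (fun t ω => iterate g β βsq η lam xinit (fun s => ξ s ω) t) σ)
    (hseg : ∀ᵐ ω ∂μ, ∀ t : ℕ, 1 ≤ t →
      segment ℝ (iterate g β βsq η lam xinit (fun s => ξ s ω) t)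
        (iterate g β βsq η lam xinit (fun s => ξ s ω) (t + 1)) ⊆ D)
    (hlamG : 2 * lam ≤ G) (hσG : 2 * σ ≤ G) (hgrad : 2 * ‖gradient f xinit‖ ≤ G)
    (h₀ : C₁ * gap f D xinit * L₀ / lam ≤ G)
    (h₁ : (C₁ * gap f D xinit * Lρ / lam) ^ (1 / (1 - ρ)) ≤ G)
    (hβsq : 0 ≤ βsq) (hβsq1 : βsq ≤ 1)
    (hadm : Admissible c₁ c₂ δ ε σ lam L₀ Lρ ρ G β η) (T : ℕ)
    (hT : T = horizon C₂ (gap f D xinit) G ε β η) :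
    ENNReal.ofReal (1 - δ) ≤
      μ {ω | (∀ t ∈ Finset.Icc 1 T,
          ‖gradient f (iterate g β βsq η lam xinit (fun s => ξ s ω) t)‖ ≤ G) ∧
        (1 / (T : ℝ)) * ∑ t ∈ Finset.Icc 1 T,
          ‖gradient f (iterate g β βsq η lam xinit (fun s => ξ s ω) t)‖ ^ 2 ≤ ε ^ 2} := by
  set w := Real.sqrt (Real.log (1 / δ)) with hwdef
  set L := effSmooth L₀ Lρ ρ G with hLdef
  set Δ := gap f D xinit with hΔdef
  have hG : 0 < G := by linarith
  have hw : 0 < w := hw₀.trans_le hδw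
  have hβ := hadm.β_pos
  have hη := hadm.η_pos
  have hβ1 := hadm.β_le_one
  have hL : 0 ≤ L := effSmooth_nonneg hL₀ hLρ hG.le
  have hΔ : 0 ≤ Δ := gap_nonneg hinit hbdd
  have hC0 : 0 < C := by rw [hC]; positivity
  have hC₂0 : 0 < C₂ := by linarith
  have hβle := hadm.β_mul_le hc₁0.le hlam.le
  have hηle := hadm.η_mul_le hc₂0.le
  have hlow := le_horizon C₂ Δ G ε β η
  rw [← hT] at hlow
  have hTβ : 1 ≤ β ^ 2 * T := by
    have := (le_max_left _ _).trans hlow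
    rwa [div_le_iff₀ (by positivity), mul_comm] at this
  have hT0 : (0 : ℝ) < T := lt_of_lt_of_le (by positivity) ((le_max_left _ _).trans hlow)
  have hup : (T : ℝ) ≤ 2 * (1 / β ^ 2) + 2 * (C₂ * Δ * G / (η * ε ^ 2)) := by
    rw [hT]; exact horizon_le hβ hβ1 (by positivity)
  have hbudget := noise_budget hlam hG hβ hη hε hL hΔ hw hC0 hC₁ hC₂0 hσ hσG hc₁ hc₂
    (effSmooth_mul_gap_le hlam hG (by linarith) hΔ hLρ hρ1 h₀ h₁) hβle hηle hup
  -- The ratio of `L * (η / lam)` to `β` that the condition on `η` guarantees.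
  set q : ℝ := c₂ * lam / (G * w) with hq
  have hq0 : 0 ≤ q := by positivity
  have hLq : L * (η / lam) ≤ q * β := by
    have h1 : q * β = c₂ * (lam ^ 2 * β) / (lam * (G * w)) := by rw [hq]; field_simp
    rw [h1, mul_div_assoc', div_le_div_iff₀ hlam (by positivity)]
    have := mul_le_mul_of_nonneg_right hηle hlam.le
    linarith
  have hcw : c₂ / w ≤ 1 / 10 := by
    rw [div_le_div_iff₀ hw (by norm_num)]; linarith
  have hcw0 : 0 ≤ c₂ / w := by positivity
  have hqeq : q * G = c₂ / w * lam := by rw [hq]; field_simp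
  have hq20 : q ≤ 1 / 20 := by
    have h1 : q * G ≤ 1 / 10 * (G / 2) := by
      rw [hqeq]; exact mul_le_mul hcw (by linarith) hlam.le (by norm_num)
    exact le_of_mul_le_mul_right (by linarith) hG
  have hq6 : 6 * q ^ 2 ≤ 1 := by nlinarith
  have hqG : 192 * q ^ 2 * G ≤ lam := by
    have h1 : q * (q * G) ≤ 1 / 20 * (1 / 10 * lam) := by
      rw [hqeq]
      exact mul_le_mul hq20 (by gcongr) (by positivity) (by norm_num)
    linarith
  have hL8 : L * (η / lam) ≤ 1 / 8 :=
    hLq.trans ((mul_le_mul hq20 hβ1 hβ.le (by norm_num)).trans (by norm_num))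
  have hι : 0 ≤ Real.log (1 / δ) := (Real.sqrt_pos.1 hw).le
  have hbad := hN.measure_lt_sum_crossTerm_le hg hξ hβ hβ1 hTβ hι
  rw [Real.exp_neg, Real.exp_log (by positivity), one_div, inv_inv, ← one_div] at hbad
  set good : Set Ω := {ω | (∀ t ∈ Finset.Icc 1 T,
      ‖gradient f (iterate g β βsq η lam xinit (fun s => ξ s ω) t)‖ ≤ G) ∧
    (1 / (T : ℝ)) * ∑ t ∈ Finset.Icc 1 T,
      ‖gradient f (iterate g β βsq η lam xinit (fun s => ξ s ω) t)‖ ^ 2 ≤ ε ^ 2} with hgood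
  set bad : Set Ω := {ω | 6 * σ ^ 2 * (β ^ 2 * T) * w < ∑ k ∈ Finset.range T,
    crossTerm f g β βsq η lam xinit (fun s => ξ s ω) k} with hbaddef
  -- A covering and subadditivity replace complements, so `good` need not be measurable.
  have hcover : ∀ᵐ ω ∂μ, ω ∈ (univ : Set Ω) → ω ∈ bad ∪ good := by
    filter_upwards [hN.ae_norm_noise_le, hseg] with ω hnoise hsegω _
    by_cases hω : ω ∈ bad
    · exact Or.inl hω
    right
    have hS := sum_averaged_noise_le hβ hβ1 hw₀ hδw hTβ hnoise (not_lt.1 hω)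
    rw [← hC] at hS
    obtain ⟨hall, hsum⟩ := gradients_along_run hf hD hinit hbdd hL₀ hLρ hρ hρ1 hlam hlamG hσG hβ
      hβ1 hβsq hβsq1 hη hnoise (fun k => hsegω (k + 1) (by omega))
      (hadm.step_le_radius hc₂0.le hc₂half hlam hG) hL8 hLq hq6 hqG hgrad hS hbudget
    refine ⟨fun t ht => hall (t - 1) ?_, ?_⟩
    · rw [Finset.mem_Icc] at ht; omega
    · rw [sum_Icc_iterate g (fun s => ξ s ω) (fun x => ‖gradient f x‖ ^ 2) T]
      exact mean_sq_le hlam hG hη hε hC0 hC₂ hΔ hc₁' hT0 hβle ((le_max_right _ _).trans hlow) hsum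
  have hone : 1 ≤ ENNReal.ofReal δ + μ good := by
    calc (1 : ℝ≥0∞) = μ univ := measure_univ.symm
      _ ≤ μ (bad ∪ good) := measure_mono_ae hcover
      _ ≤ μ bad + μ good := measure_union_le _ _
      _ ≤ _ := by gcongr
  rw [ENNReal.ofReal_sub _ hδ.le, ENNReal.ofReal_one]
  exact tsub_le_iff_left.2 hone

end convergence

end AdamConv

/-! ### Choice of the constants. -/

theorem mainTheorem2 (δ₀ : ℝ) (hδ₀ : 0 < δ₀) (hδ₀' : δ₀ < 1) :
    ∃ C₀ : ℝ, 0 < C₀ ∧ ∀ C₁ C₂ : ℝ, C₀ ≤ C₁ → C₀ ≤ C₂ →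
    ∃ c₀ : ℝ, 0 < c₀ ∧ ∀ c₁ c₂ : ℝ, 0 < c₁ → c₁ ≤ c₀ → 0 < c₂ → c₂ ≤ c₀ →
      -- bounded gradients and convergence
      (∀ (d : ℕ) (Ω Ξ : Type*) [MeasurableSpace Ω] [MeasurableSpace Ξ]
        (μ : MeasureTheory.Measure Ω) [MeasureTheory.IsProbabilityMeasure μ]
        (f : AdamConv.Vec d → ℝ) (D : Set (AdamConv.Vec d))
        (g : AdamConv.Vec d → Ξ → AdamConv.Vec d) (ξ : ℕ → Ω → Ξ) (xinit : AdamConv.Vec d)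
        (L₀ Lρ ρ σ lam δ ε G β βsq η : ℝ),
        0 ≤ L₀ → 0 ≤ Lρ → 0 ≤ ρ → ρ < 1 → 0 ≤ σ → 0 < lam → 0 < δ → δ ≤ δ₀ → 0 < ε →
        -- the objective
        IsOpen D → xinit ∈ D → BddBelow (f '' D) →
        AdamConv.IsL0LrhoSmoothOn f D L₀ Lρ ρ →
        -- the stochastic gradients; the run takes place in the domain of `f`
        Measurable (fun p : AdamConv.Vec d × Ξ => g p.1 p.2) → (∀ t, Measurable (ξ t)) →
        AdamConv.BoundedNoise μ f g ξ
          (fun t ω => AdamConv.iterate g β βsq η lam xinit (fun s => ξ s ω) t) σ →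
        (∀ᵐ ω ∂μ, ∀ t : ℕ, 1 ≤ t →
          segment ℝ (AdamConv.iterate g β βsq η lam xinit (fun s => ξ s ω) t)
            (AdamConv.iterate g β βsq η lam xinit (fun s => ξ s ω) (t + 1)) ⊆ D) →
        -- the parameters
        2 * lam ≤ G → 2 * σ ≤ G → 2 * ‖gradient f xinit‖ ≤ G →
        C₁ * AdamConv.gap f D xinit * L₀ / lam ≤ G →
        (C₁ * AdamConv.gap f D xinit * Lρ / lam) ^ (1 / (1 - ρ)) ≤ G →
        0 ≤ βsq → βsq ≤ 1 →
        AdamConv.Admissible c₁ c₂ δ ε σ lam L₀ Lρ ρ G β η →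
        ∀ T : ℕ, T = AdamConv.horizon C₂ (AdamConv.gap f D xinit) G ε β η →
        ENNReal.ofReal (1 - δ) ≤
          μ {ω | (∀ t ∈ Finset.Icc 1 T,
                ‖gradient f (AdamConv.iterate g β βsq η lam xinit (fun s => ξ s ω) t)‖ ≤ G) ∧
              (1 / (T : ℝ)) * ∑ t ∈ Finset.Icc 1 T,
                ‖gradient f (AdamConv.iterate g β βsq η lam xinit (fun s => ξ s ω) t)‖ ^ 2
                  ≤ ε ^ 2}) ∧
      -- dimension-free complexity of order `ε⁻⁴`: `K` depends on neither `d` nor `ε`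
      (∀ L₀ Lρ ρ σ lam δ G Δ₁ : ℝ,
        0 ≤ L₀ → 0 ≤ Lρ → 0 ≤ ρ → ρ < 1 → 0 ≤ σ → 0 < lam → 0 < δ → δ ≤ δ₀ → 0 < G → 0 ≤ Δ₁ →
        ∃ K : ℝ, 0 < K ∧ ∀ ε : ℝ, 0 < ε → ε ≤ 1 →
          ∃ β η : ℝ, AdamConv.Admissible c₁ c₂ δ ε σ lam L₀ Lρ ρ G β η ∧
            (AdamConv.horizon C₂ Δ₁ G ε β η : ℝ) ≤ K / ε ^ 4) := by
  have hι₀ : 0 < Real.log (1 / δ₀) := Real.log_pos (by rw [lt_div_iff₀ hδ₀]; linarith)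
  set w₀ := Real.sqrt (Real.log (1 / δ₀)) with hw₀def
  have hw₀ : 0 < w₀ := Real.sqrt_pos.2 hι₀
  set C : ℝ := 6 + 5 / w₀ with hC
  have hC0 : 0 < C := by positivity
  refine ⟨20000, by norm_num, fun C₁ C₂ hC₁ hC₂ => ?_⟩
  have hC₂0 : 0 < C₂ := by linarith
  -- In turn: steps stay within the radius, the lag is absorbed, the noise is small against `G` and
  -- `ε`, and the noise over the gap part of `T` is within budget.
  refine ⟨min (min (1 / 2) (w₀ / 10)) (min (1 / (5000 * C)) (1 / (8 * C * C₂))), by positivity,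
    fun c₁ c₂ hc₁ hc₁' hc₂ hc₂' => ?_⟩
  simp only [le_min_iff] at hc₁' hc₂'
  obtain ⟨-, hc₁a, hc₁b⟩ := hc₁'
  obtain ⟨⟨hc₂a, hc₂b⟩, hc₂c, -⟩ := hc₂'
  rw [le_div_iff₀ (by positivity)] at hc₁a hc₁b hc₂b hc₂c
  refine ⟨?_, ?_⟩
  · intro d Ω Ξ _ _ μ _ f D g ξ xinit L₀ Lρ ρ σ lam δ ε G β βsq η hL₀ hLρ hρ hρ1 hσ hlam hδ hδδ₀ hε
      hD hinit hbdd hf hg hξ hN hseg hlamG hσG hgrad h₀ h₁ hβsq hβsq1 hadm T hT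
    have hδw : w₀ ≤ Real.sqrt (Real.log (1 / δ)) :=
      Real.sqrt_le_sqrt (Real.log_le_log (by positivity) (by gcongr))
    exact AdamConv.convergence hw₀ hC hC₁ hC₂ hc₁ (by linarith) (by linarith) hc₂ (by linarith)
      hc₂a (by linarith) hL₀ hLρ hρ hρ1 hσ hlam hδ hδw hε hD hinit hbdd hf hg hξ hN hseg hlamG hσG
      hgrad h₀ h₁ hβsq hβsq1 hadm T hT
  · intro L₀ Lρ ρ σ lam δ G Δ₁ hL₀ _ hρ _ _ hlam _ _ hG hΔ₁
    exact AdamConv.exists_admissible hc₁ hc₂ hC₂0 hL₀ hρ hlam hG hΔ₁
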